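/- Work over $\mathbb{C}$, and let $\mathbb{A}^1_*=\mathbb{A}^1\setminus\{0\}=\operatorname{Spec}\mathbb{C}[u,u^{-1}]$. Let $n\ge 1$ and $m\ge 2$ be integers, and let $\ell,\ell'\ge 1$ be integers relatively prime to $m$ such that $\ell'\not\equiv\ell$ and $\ell'\not\equiv-\ell \pmod m$. Then the hypersurfaces $$X_{n,m,\ell}=\{t^{\ell}(x_1^2\cdots x_n^2z-y^m)=1\}\quad\text{and}\quad X_{n,m,\ell'}=\{t^{\ell'}(x_1^2\cdots x_n^2z-y^m)=1\}$$ in $\mathbb{A}^{n+3}=\operatorname{Spec}\mathbb{C}[x_1,\dots,x_n,y,z,t]$ are factorial affine varieties (that is, integral affine schemes of finite type over $\mathbb{C}$ whose coordinate rings are unique factorization domains) of dimension $n+2$. They are not isomorphic as complex algebraic varieties, but the cylinders $X_{n,m,\ell}\times\mathbb{A}^1_*$ and $X_{n,m,\ell'}\times\mathbb{A}^1_*$ are isomorphic as complex algebraic varieties. -/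

import Mathlib

open CategoryTheory CategoryTheory.Limits AlgebraicGeometry

noncomputable section

namespace LaurentCancellation

/-- Schemes over the field of complex numbers; their morphisms are the morphisms of schemes
compatible with the structure morphisms to `Spec ℂ`. -/
abbrev SchemeOverC : Type 1 := Over (Spec (CommRingCat.of ℂ))

/-- `Spec A` as a scheme over `ℂ`, for a commutative `ℂ`-algebra `A`. -/
def specOver (A : Type) [CommRing A] [Algebra ℂ A] : SchemeOverC :=
  Over.mk (Spec.map (CommRingCat.ofHom (algebraMap ℂ A)))

/-- The punctured affine line `𝔸¹ ∖ {0} = Spec ℂ[u, u⁻¹]` over `ℂ`. -/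
def puncturedLine : SchemeOverC := specOver (LaurentPolynomial ℂ)

/-- The cylinder `X × (𝔸¹ ∖ {0})`, where the product is the fibre product over `Spec ℂ`. -/
def puncturedCylinder (X : SchemeOverC) : SchemeOverC :=
  Over.mk (pullback.fst X.hom puncturedLine.hom ≫ X.hom)

/-- The coordinates `x₁, …, xₙ, y, z, t` of the affine space of dimension `n + 3`. -/
abbrev Coord (n : ℕ) : Type := Fin n ⊕ Fin 3

/-- The coordinate function `xᵢ`. -/
def xVar {n : ℕ} (i : Fin n) : MvPolynomial (Coord n) ℂ := MvPolynomial.X (Sum.inl i)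

/-- The coordinate function `y`. -/
def yVar (n : ℕ) : MvPolynomial (Coord n) ℂ := MvPolynomial.X (Sum.inr 0)

/-- The coordinate function `z`. -/
def zVar (n : ℕ) : MvPolynomial (Coord n) ℂ := MvPolynomial.X (Sum.inr 1)

/-- The coordinate function `t`. -/
def tVar (n : ℕ) : MvPolynomial (Coord n) ℂ := MvPolynomial.X (Sum.inr 2)

/-- The polynomial `t ^ ℓ * (x₁² ⋯ xₙ² z - y ^ m) - 1`. -/
def equation (n m l : ℕ) : MvPolynomial (Coord n) ℂ :=
  tVar n ^ l * ((∏ i : Fin n, xVar i ^ 2) * zVar n - yVar n ^ m) - 1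

/-- The hypersurface `t ^ ℓ * (x₁² ⋯ xₙ² z - y ^ m) = 1` of the affine space
`Spec ℂ[x₁, …, xₙ, y, z, t]`, that is, the closed subscheme defined by the ideal that the
equation generates. -/
def hypersurface (n m l : ℕ) : SchemeOverC :=
  specOver (MvPolynomial (Coord n) ℂ ⧸ Ideal.span {equation n m l})

/-- A factorial affine complex variety: an integral affine scheme of finite type over `ℂ` whose
ring of regular functions is a unique factorization domain. -/
structure IsFactorialAffineVariety (X : SchemeOverC) : Prop where
  isAffine : IsAffine X.left
  isIntegral : IsIntegral X.left
  finiteType : LocallyOfFiniteType X.hom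
  factorial : UniqueFactorizationMonoid Γ(X.left, ⊤)

end LaurentCancellation

end

/-!
Let `A_ℓ` be the coordinate ring of the hypersurface with exponent `ℓ`; the function `t` is a unit
of it, because `t ^ ℓ (x₁² ⋯ xₙ² z - y ^ m) = 1`.

*Cylinders.* Choose integers with `ℓ q - m p = 1`. On the cylinder with coordinate `u` the
monomials `t ^ ℓ u ^ m` and `t ^ p u ^ q` are coordinates of the torus with coordinates `t`, `u`.
Rescaling `y` by `u⁻¹` and `z` by `u ^ (-m)`, the equation involves only the first of them, and it
becomes the equation with exponent `1`. So `A_ℓ[u, u⁻¹]` is isomorphic to `A_1[u, u⁻¹]`, for every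
`ℓ` prime to `m` (`HypersurfaceRing.nonempty_cylinderEquiv`).

*Factoriality and dimension.* The ring `A_1` is a localization of a polynomial ring, hence
factorial, and so is `A_1[u, u⁻¹] ≅ A_ℓ[u, u⁻¹]`. Factoriality descends from a Laurent polynomial
ring to its ring of constants by Kaplansky's criterion, since divisors of nonzero constants are
monomials (`uniqueFactorizationMonoid_of_laurent`). The dimension is at most `n + 2` because the
equation is not a zero divisor, and at least `n + 2` because `A_ℓ / (x₁)` maps onto
`ℂ[x₂, …, xₙ, z][τ, τ⁻¹]` (`HypersurfaceRing.evalDivisor`): on the divisor `x₁ = 0` one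
has `t ^ ℓ y ^ m = -1`, which is parametrized by `y = ζ τ ^ ℓ`, `t = τ ^ (-m)` with `ζ ^ m = -1`.

*Locally nilpotent derivations.* Let `D` be a nonzero locally nilpotent derivation of `A_ℓ`; it
annihilates the unit `t`. Give `x_{i₀}` the weight `-1` and `z` the weight `2`, and the other coordinates the
weight `0`; the equation is homogeneous. The component of `D` of largest degree is again locally
nilpotent, and it does not annihilate `z` by a comparison of degrees
(`HypersurfaceRing.derivation_z_ne_zero`). As elements of positive weight are divisible by `z` and a
locally nilpotent derivation annihilates every element which divides its own derivative, the degree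
of the component is at most `-2`. Hence `D x_{i₀}` has negative weights only, so it is
divisible by `x_{i₀}`, and therefore vanishes (`HypersurfaceRing.derivation_x_eq_zero`). It follows
that `D` is a multiple of `x₁² ⋯ xₙ² ∂/∂y + m y ^ (m - 1) ∂/∂z`
(`HypersurfaceRing.exists_eq_smul_stdDerivation`), whose kernel is `ℂ[x₁, …, xₙ][t, t⁻¹]`. In
particular the units of `A_ℓ` are the monomials `c t ^ k`.

*Isomorphisms.* Let `φ` be an isomorphism from `A_ℓ` to `A_ℓ'`. Transporting the derivation shows
that `φ y = p₀ + p₁ y` with `p₀` in the kernel and `p₁` a unit, hence a monomial `d t ^ k`, and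
that `x₁² ⋯ xₙ²` divides its own image; moreover `φ t = c t ^ ε` with `ε = ± 1`. Restrict to the
divisor `x₁ = 0` of the target. The equation becomes `-φ(t) ^ ℓ φ(y) ^ m = 1`, so that `φ y` is a
monomial in `τ`. Its summand coming from `p₀` has only exponents divisible by `m`, whereas the other
one has the exponent `ℓ' - m k`, which is prime to `m`. So the exponent of `φ y` is `ℓ' - m k`, and
comparison with `φ t = c τ ^ (-m ε)` in the equation gives `ℓ' - m k = ε ℓ`
(`HypersurfaceRing.modEq_of_algEquiv`).
-/

namespace LaurentCancellation

/-! ### Locally nilpotent derivations -/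

noncomputable section LND

open Polynomial

variable {k A : Type*} [Field k] [CommRing A] [Algebra k A]

/-- A derivation is locally nilpotent if every element is killed by some iterate of it. -/
def IsLocallyNilpotent (D : Derivation k A A) : Prop :=
  ∀ a, ∃ N : ℕ, D^[N] a = 0

theorem iterate_eq_zero_of_le {D : Derivation k A A} {a : A} {N M : ℕ} (h : D^[N] a = 0)
    (hNM : N ≤ M) : D^[M] a = 0 := by
  obtain ⟨r, rfl⟩ := Nat.exists_eq_add_of_le' hNM
  rw [Function.iterate_add_apply, h, iterate_map_zero]

theorem iterate_leibniz (D : Derivation k A A) (n : ℕ) (a b : A) :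
    D^[n] (a * b) =
      ∑ ij ∈ Finset.HasAntidiagonal.antidiagonal n,
        (n.choose ij.1 : A) * (D^[ij.1] a * D^[ij.2] b) := by
  induction n with
  | zero => simp
  | succ n ih =>
    rw [Finset.sum_antidiagonal_choose_succ_mul
      (fun i j => D^[i] a * D^[j] b)]
    simp only [Function.iterate_succ_apply', ih, map_sum, Derivation.leibniz, smul_eq_mul,
      Derivation.map_natCast, mul_zero, add_zero]
    rw [← Finset.sum_add_distrib]
    refine Finset.sum_congr rfl fun ij hij => ?_
    rw [Nat.choose_symm_of_eq_add (Finset.HasAntidiagonal.mem_antidiagonal.mp hij).symm]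
    ring

theorem exists_iterate_mul_eq_zero {D : Derivation k A A} {a b : A}
    (ha : ∃ N : ℕ, D^[N] a = 0) (hb : ∃ N : ℕ, D^[N] b = 0) :
    ∃ N : ℕ, D^[N] (a * b) = 0 := by
  obtain ⟨N, hN⟩ := ha
  obtain ⟨M, hM⟩ := hb
  refine ⟨N + M, ?_⟩
  rw [iterate_leibniz]
  refine Finset.sum_eq_zero fun ij hij => ?_
  rw [Finset.HasAntidiagonal.mem_antidiagonal] at hij
  rcases le_or_gt N ij.1 with h | h
  · rw [iterate_eq_zero_of_le hN h, zero_mul, mul_zero]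
  · rw [iterate_eq_zero_of_le hM (by omega : M ≤ ij.2), mul_zero, mul_zero]

theorem exists_iterate_add_eq_zero {D : Derivation k A A} {a b : A}
    (ha : ∃ N : ℕ, D^[N] a = 0) (hb : ∃ N : ℕ, D^[N] b = 0) :
    ∃ N : ℕ, D^[N] (a + b) = 0 := by
  obtain ⟨N, hN⟩ := ha
  obtain ⟨M, hM⟩ := hb
  refine ⟨N + M, ?_⟩
  rw [iterate_map_add, iterate_eq_zero_of_le hN (by omega), iterate_eq_zero_of_le hM (by omega),
    add_zero]

/-- The elements killed by some iterate of a derivation form a subalgebra. -/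
def nilSubalgebra (D : Derivation k A A) : Subalgebra k A where
  carrier := {a | ∃ N : ℕ, D^[N] a = 0}
  mul_mem' := exists_iterate_mul_eq_zero
  add_mem' := exists_iterate_add_eq_zero
  algebraMap_mem' r := ⟨1, by simp⟩

theorem mem_nilSubalgebra_of_apply {D : Derivation k A A} {a : A} (h : D a ∈ nilSubalgebra D) :
    a ∈ nilSubalgebra D := by
  obtain ⟨N, hN⟩ := h
  exact ⟨N + 1, by rwa [Function.iterate_succ_apply]⟩

section Taylor

variable {D : Derivation k A A}

open scoped Nat

/-- The polynomial `exp (T D) a = ∑ Dⁱ(a) Tⁱ / i!`. -/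
def taylorPoly (D : Derivation k A A) (hD : IsLocallyNilpotent D) (a : A) : A[X] :=
  ∑ i ∈ Finset.range (hD a).choose, monomial i (((i ! : k)⁻¹) • D^[i] a)

theorem coeff_taylorPoly (hD : IsLocallyNilpotent D) (a : A) (n : ℕ) :
    (taylorPoly D hD a).coeff n = ((n ! : k)⁻¹) • D^[n] a := by
  simp only [taylorPoly, finsetSum_coeff, coeff_monomial, Finset.sum_ite_eq', Finset.mem_range]
  split_ifs with h
  · rfl
  · rw [iterate_eq_zero_of_le (hD a).choose_spec (not_lt.mp h), smul_zero]

variable [CharZero k]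

/-- The exponential `a ↦ exp (T D) a` of a locally nilpotent derivation. -/
def taylor (D : Derivation k A A) (hD : IsLocallyNilpotent D) : A →ₐ[k] A[X] where
  toFun := taylorPoly D hD
  map_one' := by
    ext n
    rw [coeff_taylorPoly, coeff_one]
    cases n <;> simp [Function.iterate_succ_apply]
  map_zero' := by ext n; simp [coeff_taylorPoly]
  map_add' a b := by ext n; simp [coeff_taylorPoly, iterate_map_add]
  map_mul' a b := by
    ext n
    rw [coeff_taylorPoly, coeff_mul, iterate_leibniz, Finset.smul_sum]
    refine Finset.sum_congr rfl fun ij hij => ?_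
    rw [coeff_taylorPoly, coeff_taylorPoly, smul_mul_smul_comm]
    rw [Finset.HasAntidiagonal.mem_antidiagonal] at hij
    subst hij
    rw [← map_natCast (algebraMap k A), ← Algebra.smul_def, smul_smul]
    congr 1
    have h1 : ((ij.1 + ij.2) ! : k) ≠ 0 := by exact_mod_cast Nat.factorial_ne_zero _
    have h2 : (ij.1 ! : k) ≠ 0 := by exact_mod_cast Nat.factorial_ne_zero _
    have h3 : (ij.2 ! : k) ≠ 0 := by exact_mod_cast Nat.factorial_ne_zero _
    have h4 : (((ij.1 + ij.2).choose ij.1 : ℕ) : k) * ij.1 ! * ij.2 ! = (ij.1 + ij.2)! := by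
      rw [Nat.choose_symm_add]
      exact_mod_cast Nat.add_choose_mul_factorial_mul_factorial ij.1 ij.2
    field_simp
    linear_combination h4
  commutes' r := by
    ext n
    rw [coeff_taylorPoly, Polynomial.algebraMap_apply, coeff_C]
    cases n <;> simp [Function.iterate_succ_apply]

theorem coeff_taylor (hD : IsLocallyNilpotent D) (a : A) (n : ℕ) :
    (taylor D hD a).coeff n = ((n ! : k)⁻¹) • D^[n] a :=
  coeff_taylorPoly hD a n

theorem taylor_injective (hD : IsLocallyNilpotent D) : Function.Injective (taylor D hD) := by
  intro a b h
  simpa [coeff_taylor] using congrArg (fun p => p.coeff 0) h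

theorem taylor_apply_derivation (hD : IsLocallyNilpotent D) (a : A) :
    taylor D hD (D a) = derivative (taylor D hD a) := by
  ext n
  rw [coeff_taylor, coeff_derivative, coeff_taylor, ← Function.iterate_succ_apply]
  have h1 : ((n + 1 : ℕ) : k) ≠ 0 := by exact_mod_cast Nat.succ_ne_zero n
  have h2 : ((n : A) + 1) = algebraMap k A ((n + 1 : ℕ) : k) := by simp
  rw [h2, mul_comm, ← Algebra.smul_def, smul_smul, Nat.factorial_succ, Nat.cast_mul, mul_inv,
    mul_inv_cancel_left₀ h1]

theorem taylor_eq_C (hD : IsLocallyNilpotent D) {a : A} (ha : D a = 0) : taylor D hD a = C a := by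
  ext n
  rw [coeff_taylor, coeff_C]
  cases n <;> simp [Function.iterate_succ_apply, ha]

/-- The degree of an element with respect to a locally nilpotent derivation: the largest `n`
such that `Dⁿ` does not kill it (and `0` for the zero element). -/
def lndDegree (D : Derivation k A A) (hD : IsLocallyNilpotent D) (a : A) : ℕ :=
  (taylor D hD a).natDegree

theorem lndDegree_add_of_apply_eq_zero (hD : IsLocallyNilpotent D) {a c : A} (hc : D c = 0) :
    lndDegree D hD (a + c) = lndDegree D hD a := by
  rw [lndDegree, map_add, taylor_eq_C hD hc, natDegree_add_C, lndDegree]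

variable [IsDomain A]

theorem lndDegree_mul (hD : IsLocallyNilpotent D) {a b : A} (ha : a ≠ 0) (hb : b ≠ 0) :
    lndDegree D hD (a * b) = lndDegree D hD a + lndDegree D hD b := by
  rw [lndDegree, map_mul, natDegree_mul, lndDegree, lndDegree] <;>
  simpa [map_eq_zero_iff _ (taylor_injective hD)]

theorem lndDegree_pow (hD : IsLocallyNilpotent D) (a : A) (n : ℕ) :
    lndDegree D hD (a ^ n) = n * lndDegree D hD a := by
  rw [lndDegree, map_pow, natDegree_pow, lndDegree]

theorem charZero_of_domain_algebra (k A : Type*) [Field k] [CharZero k] [CommRing A] [IsDomain A]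
    [Algebra k A] : CharZero A :=
  charZero_of_injective_algebraMap (algebraMap k A).injective

theorem lndDegree_eq_zero_iff (hD : IsLocallyNilpotent D) {a : A} :
    lndDegree D hD a = 0 ↔ D a = 0 := by
  have := charZero_of_domain_algebra k A
  constructor
  · intro h
    have h1 := taylor_apply_derivation hD a
    rw [derivative_of_natDegree_zero h] at h1
    exact (map_eq_zero_iff _ (taylor_injective hD)).mp h1
  · intro h
    rw [lndDegree, taylor_eq_C hD h, natDegree_C]

theorem lndDegree_apply (hD : IsLocallyNilpotent D) (a : A) :
    lndDegree D hD (D a) = lndDegree D hD a - 1 := by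
  have := charZero_of_domain_algebra k A
  rw [lndDegree, taylor_apply_derivation, natDegree_derivative, lndDegree]

theorem lndDegree_le_of_dvd (hD : IsLocallyNilpotent D) {a b : A} (hb : b ≠ 0) (h : a ∣ b) :
    lndDegree D hD a ≤ lndDegree D hD b := by
  obtain ⟨c, rfl⟩ := h
  rw [lndDegree_mul hD (left_ne_zero_of_mul hb) (right_ne_zero_of_mul hb)]
  exact Nat.le_add_right _ _

/-- The kernel of a locally nilpotent derivation of a domain is factorially closed. -/
theorem apply_eq_zero_of_dvd (hD : IsLocallyNilpotent D) {a b : A} (hb : b ≠ 0) (h : a ∣ b)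
    (hDb : D b = 0) : D a = 0 := by
  rw [← lndDegree_eq_zero_iff hD] at hDb ⊢
  have := lndDegree_le_of_dvd hD hb h
  omega

theorem apply_eq_zero_of_isUnit (hD : IsLocallyNilpotent D) {a : A} (ha : IsUnit a) : D a = 0 :=
  apply_eq_zero_of_dvd hD one_ne_zero ha.dvd (by simp)

theorem apply_eq_zero_of_dvd_apply (hD : IsLocallyNilpotent D) {a : A} (h : a ∣ D a) :
    D a = 0 := by
  by_contra h0
  have h1 := lndDegree_le_of_dvd hD h0 h
  rw [lndDegree_apply] at h1
  exact h0 ((lndDegree_eq_zero_iff hD).mp (by omega))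

end Taylor

end LND

/-! ### Homogeneous components of derivations of graded algebras -/

noncomputable section Graded

open DirectSum
open scoped Classical

variable {k A : Type*} [Field k] [CommRing A] [Algebra k A]
variable (𝒜 : ℤ → Submodule k A) [GradedAlgebra 𝒜]

theorem proj_mul_of_left_mem {i j : ℤ} {a : A} (ha : a ∈ 𝒜 i) (b : A) :
    GradedAlgebra.proj 𝒜 (i + j) (a * b) = a * GradedAlgebra.proj 𝒜 j b := by
  simp only [GradedAlgebra.proj_apply]
  exact DirectSum.coe_decompose_mul_add_of_left_mem 𝒜 ha

theorem proj_mem (i : ℤ) (a : A) : GradedAlgebra.proj 𝒜 i a ∈ 𝒜 i := by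
  rw [GradedAlgebra.proj_apply]
  exact SetLike.coe_mem _

theorem sum_proj (a : A) :
    ∑ i ∈ (decompose 𝒜 a).support, GradedAlgebra.proj 𝒜 i a = a := by
  simp only [GradedAlgebra.proj_apply]
  exact DirectSum.sum_support_decompose 𝒜 a

theorem proj_eq_zero_of_notMem {i : ℤ} {a : A} (h : i ∉ (decompose 𝒜 a).support) :
    GradedAlgebra.proj 𝒜 i a = 0 := by
  rw [GradedAlgebra.proj_apply]
  simpa using h

/-- The homogeneous component of degree `δ` of a derivation `D` of a graded algebra: it sends
a homogeneous element `a` of degree `i` to the component of degree `i + δ` of `D a`. -/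
def homogeneousPart (D : Derivation k A A) (δ : ℤ) : Derivation k A A :=
  Derivation.mk'
    (DirectSum.toModule k ℤ A
        (fun i => GradedAlgebra.proj 𝒜 (i + δ) ∘ₗ (D : A →ₗ[k] A) ∘ₗ (𝒜 i).subtype) ∘ₗ
      (decomposeLinearEquiv 𝒜 : A →ₗ[k] ⨁ i, 𝒜 i)) <| by
    intro a b
    induction a using DirectSum.Decomposition.inductionOn 𝒜 with
    | zero => simp
    | add a a' h h' => simp only [add_mul, map_add, h, h', smul_eq_mul, mul_add]; ring
    | @homogeneous i a =>
    induction b using DirectSum.Decomposition.inductionOn 𝒜 with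
    | zero => simp
    | add b b' h h' => simp only [add_mul, map_add, h, h', smul_eq_mul, mul_add]; ring
    | @homogeneous j b =>
    obtain ⟨a, ha⟩ := a
    obtain ⟨b, hb⟩ := b
    have hab : a * b ∈ 𝒜 (i + j) := SetLike.mul_mem_graded ha hb
    have key : ∀ {r : ℤ} {c : A} (hc : c ∈ 𝒜 r), (decomposeLinearEquiv 𝒜 : A →ₗ[k] ⨁ i, 𝒜 i) c
        = DirectSum.lof k ℤ (fun i => 𝒜 i) r ⟨c, hc⟩ := fun hc => decompose_of_mem 𝒜 hc
    simp only [LinearMap.comp_apply, key ha, key hb, key hab, toModule_lof, Submodule.subtype_apply,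
      Derivation.coeFn_coe, Derivation.leibniz, map_add, smul_eq_mul]
    rw [add_assoc, proj_mul_of_left_mem 𝒜 ha, ← add_assoc, add_comm i j, add_assoc,
      proj_mul_of_left_mem 𝒜 hb]

theorem homogeneousPart_of_mem (D : Derivation k A A) (δ : ℤ) {i : ℤ} {a : A} (ha : a ∈ 𝒜 i) :
    homogeneousPart 𝒜 D δ a = GradedAlgebra.proj 𝒜 (i + δ) (D a) := by
  have key : (decomposeLinearEquiv 𝒜 : A →ₗ[k] ⨁ i, 𝒜 i) a
      = DirectSum.lof k ℤ (fun i => 𝒜 i) i ⟨a, ha⟩ := decompose_of_mem 𝒜 ha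
  change (DirectSum.toModule k ℤ A _) ((decomposeLinearEquiv 𝒜 : A →ₗ[k] ⨁ i, 𝒜 i) a) = _
  rw [key, toModule_lof]
  rfl

theorem proj_derivation_of_mem (D : Derivation k A A) {i : ℤ} (j : ℤ) {a : A} (ha : a ∈ 𝒜 i) :
    GradedAlgebra.proj 𝒜 j (D a) = homogeneousPart 𝒜 D (j - i) a := by
  rw [homogeneousPart_of_mem 𝒜 D _ ha, add_sub_cancel]

theorem homogeneousPart_mem (D : Derivation k A A) (δ : ℤ) {i : ℤ} {a : A} (ha : a ∈ 𝒜 i) :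
    homogeneousPart 𝒜 D δ a ∈ 𝒜 (i + δ) := by
  rw [homogeneousPart_of_mem 𝒜 D δ ha]
  exact proj_mem 𝒜 _ _

theorem proj_derivation (D : Derivation k A A) (j : ℤ) (a : A) :
    GradedAlgebra.proj 𝒜 j (D a) =
      ∑ i ∈ (decompose 𝒜 a).support, homogeneousPart 𝒜 D (j - i) (GradedAlgebra.proj 𝒜 i a) := by
  conv_lhs => rw [← sum_proj 𝒜 a, map_sum, map_sum]
  exact Finset.sum_congr rfl fun i _ => proj_derivation_of_mem 𝒜 D j (proj_mem 𝒜 i a)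

theorem exists_homogeneousPart_ne_zero {D : Derivation k A A} (hD : D ≠ 0) :
    ∃ δ, homogeneousPart 𝒜 D δ ≠ 0 := by
  by_contra! h
  refine hD (Derivation.ext fun a => ?_)
  rw [← sum_proj 𝒜 (D a)]
  refine Finset.sum_eq_zero fun j _ => ?_
  rw [proj_derivation]
  exact Finset.sum_eq_zero fun i _ => by rw [h, Derivation.zero_apply]

theorem exists_bound_homogeneousPart (D : Derivation k A A) {S : Set A} (hS : S.Finite)
    (hom : ∀ a ∈ S, ∃ i, a ∈ 𝒜 i) (hadj : Algebra.adjoin k S = ⊤) :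
    ∃ N : ℤ, ∀ δ, N < δ → homogeneousPart 𝒜 D δ = 0 := by
  have h1 : ∀ a ∈ S, ∃ N : ℤ, ∀ δ, N < δ → homogeneousPart 𝒜 D δ a = 0 := by
    intro a ha
    obtain ⟨i, hi⟩ := hom a ha
    obtain ⟨M, hM⟩ := (decompose 𝒜 (D a)).support.bddAbove
    refine ⟨M - i, fun δ hδ => ?_⟩
    rw [homogeneousPart_of_mem 𝒜 D δ hi]
    refine proj_eq_zero_of_notMem 𝒜 fun hmem => ?_
    have := hM hmem
    omega
  choose! N hN using h1
  obtain ⟨M, hM⟩ := (hS.image N).bddAbove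
  refine ⟨M, fun δ hδ => ?_⟩
  refine Derivation.ext_of_adjoin_eq_top S hadj fun a ha => ?_
  exact hN a ha δ (lt_of_le_of_lt (hM ⟨a, ha, rfl⟩) hδ)

theorem iterate_homogeneousPart {D : Derivation k A A} {δ : ℤ}
    (htop : ∀ ε, δ < ε → homogeneousPart 𝒜 D ε = 0) {i : ℤ} {a : A} (ha : a ∈ 𝒜 i) (N : ℕ) :
    (∀ j, i + N * δ < j → GradedAlgebra.proj 𝒜 j (D^[N] a) = 0) ∧
      (homogeneousPart 𝒜 D δ)^[N] a = GradedAlgebra.proj 𝒜 (i + N * δ) (D^[N] a) := by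
  induction N with
  | zero =>
    have h : ∀ j, GradedAlgebra.proj 𝒜 j a = if i = j then a else 0 := by
      intro j
      rw [GradedAlgebra.proj_apply, decompose_of_mem 𝒜 ha, DirectSum.coe_of_apply]
      split_ifs <;> rfl
    refine ⟨fun j hj => ?_, ?_⟩
    · rw [Function.iterate_zero_apply, h, if_neg]
      simp at hj
      omega
    · simp [h]
  | succ N ih =>
    obtain ⟨ih1, ih2⟩ := ih
    refine ⟨fun j hj => ?_, ?_⟩
    · rw [Function.iterate_succ_apply', proj_derivation]
      refine Finset.sum_eq_zero fun l _ => ?_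
      rcases lt_or_ge (i + N * δ) l with hl | hl
      · rw [ih1 l hl, map_zero]
      · rw [htop, Derivation.zero_apply]
        push_cast at hj
        linarith
    · rw [Function.iterate_succ_apply', Function.iterate_succ_apply', proj_derivation, ih2]
      rw [Finset.sum_eq_single (i + N * δ)]
      · congr 2
        push_cast
        ring
      · intro l _ hne
        rcases lt_or_ge (i + N * δ) l with hl | hl
        · rw [ih1 l hl, map_zero]
        · rw [htop, Derivation.zero_apply]
          have := lt_of_le_of_ne hl hne
          push_cast
          linarith
      · intro h
        rw [proj_eq_zero_of_notMem 𝒜 h, map_zero]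

theorem isLocallyNilpotent_homogeneousPart {D : Derivation k A A} (hD : IsLocallyNilpotent D)
    {δ : ℤ} (htop : ∀ ε, δ < ε → homogeneousPart 𝒜 D ε = 0) :
    IsLocallyNilpotent (homogeneousPart 𝒜 D δ) := by
  intro a
  induction a using DirectSum.Decomposition.inductionOn 𝒜 with
  | zero => exact ⟨0, rfl⟩
  | add a b ha hb => exact exists_iterate_add_eq_zero ha hb
  | @homogeneous i a =>
    obtain ⟨N, hN⟩ := hD a
    refine ⟨N, ?_⟩
    rw [(iterate_homogeneousPart 𝒜 htop a.2 N).2, hN, map_zero]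

/-- A nonzero locally nilpotent derivation of a finitely generated graded algebra has a
homogeneous component of largest degree, and this component is again locally nilpotent. -/
theorem exists_top_homogeneousPart {D : Derivation k A A} (hD : IsLocallyNilpotent D)
    (hD0 : D ≠ 0) {S : Set A} (hS : S.Finite)
    (hom : ∀ a ∈ S, ∃ i, a ∈ 𝒜 i) (hadj : Algebra.adjoin k S = ⊤) :
    ∃ δ, homogeneousPart 𝒜 D δ ≠ 0 ∧ IsLocallyNilpotent (homogeneousPart 𝒜 D δ) ∧
      ∀ ε, δ < ε → homogeneousPart 𝒜 D ε = 0 := by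
  obtain ⟨N, hN⟩ := exists_bound_homogeneousPart 𝒜 D hS hom hadj
  obtain ⟨δ, hδ, hmax⟩ := Int.exists_greatest_of_bdd (P := fun δ => homogeneousPart 𝒜 D δ ≠ 0)
    ⟨N, fun δ hδ => not_lt.mp fun h => hδ (hN δ h)⟩ (exists_homogeneousPart_ne_zero 𝒜 hD0)
  have htop : ∀ ε, δ < ε → homogeneousPart 𝒜 D ε = 0 := fun ε hε => by
    by_contra h
    exact absurd (hmax ε h) (not_le.mpr hε)
  exact ⟨δ, hδ, isLocallyNilpotent_homogeneousPart 𝒜 hD htop, htop⟩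

section Image

variable {B : Type*} [CommRing B] [Algebra k B]

/-- The images of the homogeneous components under a homomorphism. -/
def imageGrading (𝒜 : ℤ → Submodule k A) (π : A →ₐ[k] B) (i : ℤ) : Submodule k B :=
  (𝒜 i).map π.toLinearMap

instance imageGrading.gradedMonoid (π : A →ₐ[k] B) :
    SetLike.GradedMonoid (imageGrading 𝒜 π) where
  one_mem := ⟨1, SetLike.GradedOne.one_mem, map_one π⟩
  mul_mem := by
    rintro i j _ _ ⟨a, ha, rfl⟩ ⟨b, hb, rfl⟩
    exact ⟨a * b, SetLike.mul_mem_graded ha hb, map_mul π _ _⟩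

theorem isInternal_imageGrading {π : A →ₐ[k] B} (hπ : Function.Surjective π)
    (hI : (RingHom.ker π).IsHomogeneous 𝒜) : DirectSum.IsInternal (imageGrading 𝒜 π) := by
  constructor
  · rw [injective_iff_map_eq_zero]
    intro x hx
    have hlift : ∀ i, ∃ a ∈ 𝒜 i, π a = (x i : B) := fun i => (x i).2
    choose a ha hax using hlift
    have hsum : ∑ i ∈ x.support, a i ∈ RingHom.ker π := by
      rw [RingHom.mem_ker, map_sum]
      rw [DirectSum.coeAddMonoidHom_eq_dfinsuppSum, DFinsupp.sum] at hx
      simpa only [hax] using hx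
    refine DFinsupp.ext fun j => ?_
    by_cases hj : j ∈ x.support
    · have hcomp := hI j hsum
      rw [decompose_sum, DirectSum.sum_apply, AddSubmonoidClass.coe_finsetSum,
        Finset.sum_eq_single j] at hcomp
      · rw [decompose_of_mem_same 𝒜 (ha j), RingHom.mem_ker, hax] at hcomp
        exact Subtype.ext hcomp
      · intro i _ hij
        exact decompose_of_mem_ne 𝒜 (ha i) hij
      · exact fun h => absurd hj h
    · simpa using hj
  · intro b
    obtain ⟨p, rfl⟩ := hπ b
    refine ⟨∑ i ∈ (decompose 𝒜 p).support, DirectSum.of (fun i => imageGrading 𝒜 π i) i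
      ⟨π (GradedAlgebra.proj 𝒜 i p), _, proj_mem 𝒜 i p, rfl⟩, ?_⟩
    rw [map_sum]
    simp only [DirectSum.coeAddMonoidHom_of]
    rw [← map_sum, sum_proj]

/-- The quotient of a graded algebra by a homogeneous ideal is graded. -/
abbrev imageGradedAlgebra {π : A →ₐ[k] B} (hπ : Function.Surjective π)
    (hI : (RingHom.ker π).IsHomogeneous 𝒜) : GradedAlgebra (imageGrading 𝒜 π) where
  toDecomposition := (isInternal_imageGrading 𝒜 hπ hI).chooseDecomposition

end Image

end Graded

/-! ### Laurent polynomial rings and factoriality -/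

noncomputable section Laurent

open LaurentPolynomial

section Lift

/-- The variable of `R[T;T⁻¹]` as a unit. -/
def unitT (R : Type*) [CommRing R] : R[T;T⁻¹]ˣ where
  val := T 1
  inv := T (-1)
  val_inv := by rw [← T_add]; simp
  inv_val := by rw [← T_add]; simp

theorem val_unitT (R : Type*) [CommRing R] : ((unitT R : R[T;T⁻¹]ˣ) : R[T;T⁻¹]) = T 1 := rfl

theorem val_unitT_zpow {R : Type*} [CommRing R] (k : ℤ) :
    ((unitT R ^ k : R[T;T⁻¹]ˣ) : R[T;T⁻¹]) = T k := by
  have h : ∀ j : ℕ, ((unitT R ^ j : R[T;T⁻¹]ˣ) : R[T;T⁻¹]) = T j := fun j => by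
    rw [Units.val_pow_eq_pow_val]
    change (T 1 : R[T;T⁻¹]) ^ j = T j
    rw [T_pow, mul_one]
  cases k with
  | ofNat j => simpa using h j
  | negSucc j =>
    rw [zpow_negSucc, ← Units.mul_eq_one_iff_inv_eq, h, ← T_add, Int.negSucc_eq]
    simp

theorem val_mul_unitT_zpow_zpow {R : Type*} [CommRing R] (a : R[T;T⁻¹]ˣ) (k j : ℤ) :
    (((a * unitT R ^ k) ^ j : R[T;T⁻¹]ˣ) : R[T;T⁻¹]) =
      ((a ^ j : R[T;T⁻¹]ˣ) : R[T;T⁻¹]) * T (k * j) := by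
  rw [mul_zpow, ← zpow_mul, Units.val_mul, val_unitT_zpow]

variable {A B : Type*} [CommRing A] [CommRing B] [Algebra ℂ A] [Algebra ℂ B]

/-- The homomorphism from `A[T;T⁻¹]` which extends `f` and sends `T` to the unit `u`. -/
def laurentLift (f : A →ₐ[ℂ] B) (u : Bˣ) : A[T;T⁻¹] →ₐ[ℂ] B where
  __ := LaurentPolynomial.eval₂ (f : A →+* B) u
  commutes' r := by
    change LaurentPolynomial.eval₂ (f : A →+* B) u (algebraMap ℂ A[T;T⁻¹] r) = _
    rw [LaurentPolynomial.algebraMap_apply, eval₂_C]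
    simp

@[simp]
theorem laurentLift_C (f : A →ₐ[ℂ] B) (u : Bˣ) (a : A) : laurentLift f u (C a) = f a :=
  eval₂_C (f : A →+* B) u a

@[simp]
theorem laurentLift_T (f : A →ₐ[ℂ] B) (u : Bˣ) (k : ℤ) :
    laurentLift f u (T k) = ((u ^ k : Bˣ) : B) :=
  eval₂_T (f : A →+* B) u k

/-- The inclusion of the constants into `A[T;T⁻¹]`. -/
def laurentC (A : Type*) [CommRing A] [Algebra ℂ A] : A →ₐ[ℂ] A[T;T⁻¹] where
  __ := (C : A →+* A[T;T⁻¹])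
  commutes' r := (LaurentPolynomial.algebraMap_apply r).symm

@[simp]
theorem laurentC_apply (a : A) : laurentC A a = C a := rfl

theorem laurent_algHom_ext {f g : A[T;T⁻¹] →ₐ[ℂ] B} (hC : ∀ a, f (C a) = g (C a))
    (hT : f (T 1) = g (T 1)) : f = g := by
  have hu : Units.map (f : A[T;T⁻¹] →* B) (unitT A) = Units.map (g : A[T;T⁻¹] →* B) (unitT A) :=
    Units.ext hT
  have hk : ∀ k : ℤ, f (T k) = g (T k) := fun k => by
    have := congrArg Units.val (congrArg (· ^ k) hu)
    simp only [← map_zpow, Units.coe_map, val_unitT_zpow] at this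
    exact this
  refine AlgHom.ext fun p => ?_
  induction p using LaurentPolynomial.induction_on' with
  | add p q hp hq => rw [map_add, map_add, hp, hq]
  | C_mul_T k a => rw [map_mul, map_mul, hC, hk]

end Lift

section Monomial

variable {R : Type*} [CommRing R] [IsDomain R]

/-- In a Laurent polynomial ring over a domain every divisor of a nonzero constant is a monomial. -/
theorem eq_C_mul_T_of_mul_eq_C {f g : R[T;T⁻¹]} {a : R} (ha : a ≠ 0) (h : f * g = C a) :
    ∃ (r : R) (k : ℤ), f = C r * T k := by
  obtain ⟨i, p, hp⟩ := exists_T_pow f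
  obtain ⟨j, q, hq⟩ := exists_T_pow g
  have hpq : p * q = Polynomial.C a * Polynomial.X ^ (i + j) := by
    apply Polynomial.toLaurent_injective
    rw [map_mul, hp, hq, map_mul, Polynomial.toLaurent_C, Polynomial.toLaurent_X_pow,
      Nat.cast_add, T_add, ← h]
    ring
  have h0 : p * q ≠ 0 := by
    rw [hpq]
    exact mul_ne_zero (by simpa using ha) (pow_ne_zero _ Polynomial.X_ne_zero)
  have hp0 := left_ne_zero_of_mul h0
  have hq0 := right_ne_zero_of_mul h0
  have h1 : p.natDegree + q.natDegree = i + j := by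
    rw [← Polynomial.natDegree_mul hp0 hq0, hpq, Polynomial.natDegree_C_mul_X_pow _ _ ha]
  have h2 : p.natTrailingDegree + q.natTrailingDegree = i + j := by
    rw [← Polynomial.natTrailingDegree_mul hp0 hq0, hpq, Polynomial.C_mul_X_pow_eq_monomial,
      Polynomial.natTrailingDegree_monomial ha]
  have h3 := p.natTrailingDegree_le_natDegree
  have h4 := q.natTrailingDegree_le_natDegree
  have h5 : p = Polynomial.C p.leadingCoeff * Polynomial.X ^ p.natDegree := by
    ext e
    rw [Polynomial.coeff_C_mul, Polynomial.coeff_X_pow]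
    rcases lt_trichotomy e p.natDegree with he | he | he
    · rw [if_neg he.ne, mul_zero]
      exact Polynomial.coeff_eq_zero_of_lt_natTrailingDegree (by omega)
    · rw [if_pos he, mul_one, he, Polynomial.coeff_natDegree]
    · rw [if_neg he.ne', mul_zero]
      exact Polynomial.coeff_eq_zero_of_natDegree_lt he
  refine ⟨p.leadingCoeff, p.natDegree - i, ?_⟩
  have h6 : f = Polynomial.toLaurent p * T (-i) := by
    rw [hp, mul_T_assoc]; simp
  rw [h6]
  conv_lhs => rw [h5]
  rw [map_mul, Polynomial.toLaurent_C, Polynomial.toLaurent_X_pow, mul_T_assoc, sub_eq_add_neg]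

end Monomial

section Factorial

/-- A localization of a factorial domain is factorial. -/
theorem uniqueFactorizationMonoid_of_isLocalization {R : Type*} [CommRing R] [IsDomain R]
    [UniqueFactorizationMonoid R] {M : Submonoid R} (hM : M ≤ nonZeroDivisors R) (S : Type*)
    [CommRing S] [IsDomain S] [Algebra R S] [IsLocalization M S] : UniqueFactorizationMonoid S := by
  rw [UniqueFactorizationMonoid.iff_exists_prime_mem_of_isPrime]
  intro I hI hIp
  have hcomap : I.under R ≠ ⊥ := by
    intro h
    apply hI
    rw [← IsLocalization.map_under M S I, h, Ideal.map_bot]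
  obtain ⟨p, hpI, hp⟩ := (hIp.under R).exists_mem_prime_of_ne_bot hcomap
  refine ⟨algebraMap R S p, hpI, ?_⟩
  have hprime : (Ideal.span {p}).IsPrime := (Ideal.span_singleton_prime hp.ne_zero).mpr hp
  have hdisj : Disjoint (M : Set R) (Ideal.span {p} : Ideal R) := by
    have := ((IsLocalization.isPrime_iff_isPrime_disjoint M S I).mp hIp).2
    refine this.mono_right ?_
    exact (Ideal.span_singleton_le_iff_mem _).mpr hpI
  have hmap := IsLocalization.isPrime_of_isPrime_disjoint M S _ hprime hdisj
  rw [Ideal.map_span, Set.image_singleton] at hmap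
  refine (Ideal.span_singleton_prime ?_).mp hmap
  intro h0
  exact hp.ne_zero ((map_eq_zero_iff _ (IsLocalization.injective S hM)).mp h0)

theorem uniqueFactorizationMonoid_laurent (R : Type*) [CommRing R] [IsDomain R]
    [UniqueFactorizationMonoid R] : UniqueFactorizationMonoid R[T;T⁻¹] :=
  uniqueFactorizationMonoid_of_isLocalization
    (powers_le_nonZeroDivisors_of_noZeroDivisors (Polynomial.X_ne_zero (R := R))) _

theorem isDomain_of_isDomain_laurent {R : Type*} [CommRing R] [IsDomain R[T;T⁻¹]] : IsDomain R :=
  have hinj : Function.Injective (C : R →+* R[T;T⁻¹]) := fun a b h => by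
    simpa using congrArg (fun p => p.coeff 0) h
  hinj.isDomain C

/-- A domain is factorial as soon as its Laurent polynomial ring is: a prime divisor, in the
Laurent polynomial ring, of a constant is a constant up to a power of the variable. -/
theorem uniqueFactorizationMonoid_of_laurent {R : Type*} [CommRing R] [IsDomain R]
    [UniqueFactorizationMonoid R[T;T⁻¹]] : UniqueFactorizationMonoid R := by
  rw [UniqueFactorizationMonoid.iff_exists_prime_mem_of_isPrime]
  intro I hI hIp
  obtain ⟨a, haI, ha0⟩ := Submodule.exists_mem_ne_zero_of_ne_bot hI
  let red : R[T;T⁻¹] →+* (R ⧸ I)[T;T⁻¹] := eval₂ (C.comp (Ideal.Quotient.mk I)) (unitT (R ⧸ I))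
  have hred : ∀ (r : R) (k : ℤ), red (C r * T k) = C (Ideal.Quotient.mk I r) * T k := fun r k => by
    rw [eval₂_C_mul_T, val_unitT_zpow]
    rfl
  have hker : (RingHom.ker red).IsPrime := RingHom.ker_isPrime red
  have haK : (C a : R[T;T⁻¹]) ∈ RingHom.ker red := by
    have := hred a 0
    rw [T_zero, mul_one, Ideal.Quotient.eq_zero_iff_mem.mpr haI, map_zero, zero_mul] at this
    exact this
  have hCa : (C a : R[T;T⁻¹]) ≠ 0 := by
    rw [Ne, ← degree_eq_bot_iff, degree_C ha0]
    simp
  obtain ⟨s, hs, hsa⟩ := UniqueFactorizationMonoid.exists_prime_factors _ hCa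
  have hsK : s.prod ∈ RingHom.ker red := by
    obtain ⟨u, hu⟩ := hsa.symm
    rw [← hu]
    exact Ideal.mul_mem_right _ _ haK
  obtain ⟨π, hπs, hπK⟩ := (hker.multiset_prod_mem_iff_exists_mem s).mp hsK
  have hπ := hs π hπs
  obtain ⟨g, hg⟩ := (Multiset.dvd_prod hπs).trans hsa.dvd
  obtain ⟨r, k, rfl⟩ := eq_C_mul_T_of_mul_eq_C ha0 hg.symm
  refine ⟨r, ?_, ?_⟩
  · rw [RingHom.mem_ker, hred] at hπK
    have h0 : (C (Ideal.Quotient.mk I r) : (R ⧸ I)[T;T⁻¹]) = 0 :=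
      (isUnit_T k).mul_left_eq_zero.mp hπK
    rw [← Ideal.Quotient.eq_zero_iff_mem]
    simpa using congrArg (fun p => p.coeff 0) h0
  · have hr : Prime (C r : R[T;T⁻¹]) :=
      (associated_mul_unit_left _ _ (isUnit_T k)).prime hπ
    refine comap_prime (C : R →+* R[T;T⁻¹]) (eval₂ (RingHom.id R) 1) (fun b => ?_) hr
    rw [eval₂_C, RingHom.id_apply]

end Factorial

end Laurent

/-! ### The coordinate ring of the hypersurface -/

noncomputable section Ring

/-- The coordinate ring `ℂ[x₁, …, xₙ, y, z, t] / (t ^ ℓ * (x₁² ⋯ xₙ² z - y ^ m) - 1)` of the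
hypersurface. -/
def HypersurfaceRing (n m l : ℕ) : Type :=
  MvPolynomial (Coord n) ℂ ⧸ Ideal.span {equation n m l}

instance (n m l : ℕ) : CommRing (HypersurfaceRing n m l) :=
  inferInstanceAs (CommRing (MvPolynomial (Coord n) ℂ ⧸ Ideal.span {equation n m l}))

instance (n m l : ℕ) : Algebra ℂ (HypersurfaceRing n m l) :=
  inferInstanceAs (Algebra ℂ (MvPolynomial (Coord n) ℂ ⧸ Ideal.span {equation n m l}))

namespace HypersurfaceRing

open LaurentPolynomial

variable {n m l : ℕ}

/-- The quotient map from the polynomial ring. -/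
def mk (n m l : ℕ) : MvPolynomial (Coord n) ℂ →ₐ[ℂ] HypersurfaceRing n m l :=
  Ideal.Quotient.mkₐ ℂ (Ideal.span {equation n m l})

theorem mk_surjective : Function.Surjective (mk n m l) :=
  Ideal.Quotient.mkₐ_surjective ℂ (Ideal.span {equation n m l})

/-- The regular function `xᵢ` on the hypersurface. -/
def x (i : Fin n) : HypersurfaceRing n m l := mk n m l (xVar i)

/-- The regular function `y` on the hypersurface. -/
def y : HypersurfaceRing n m l := mk n m l (yVar n)

/-- The regular function `z` on the hypersurface. -/
def z : HypersurfaceRing n m l := mk n m l (zVar n)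

/-- The regular function `t` on the hypersurface. -/
def t : HypersurfaceRing n m l := mk n m l (tVar n)

/-- The product `x₁ ⋯ xₙ`. -/
def xProd : HypersurfaceRing n m l := ∏ i, x i

theorem mk_equation : mk n m l (equation n m l) = 0 :=
  Ideal.Quotient.eq_zero_iff_mem.mpr (Ideal.mem_span_singleton_self _)

theorem relation :
    (t : HypersurfaceRing n m l) ^ l * ((∏ i, x i ^ 2) * z - y ^ m) = 1 := by
  have h := mk_equation (n := n) (m := m) (l := l)
  simp only [equation, map_sub, map_mul, map_pow, map_prod, map_one] at h
  exact sub_eq_zero.mp h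

theorem relation' :
    (t : HypersurfaceRing n m l) ^ l * (xProd ^ 2 * z - y ^ m) = 1 := by
  rw [xProd, ← Finset.prod_pow]
  exact relation

theorem isUnit_t (hl : 1 ≤ l) : IsUnit (t : HypersurfaceRing n m l) :=
  (isUnit_pow_iff (by omega)).mp (IsUnit.of_mul_eq_one _ relation)

/-- The regular function `t` as a unit; `ℓ ≠ 0` is needed for its inverse to exist. -/
def unitOfT (hl : 1 ≤ l) : (HypersurfaceRing n m l)ˣ := (isUnit_t hl).unit

@[simp]
theorem val_unitOfT (hl : 1 ≤ l) :
    ((unitOfT hl : (HypersurfaceRing n m l)ˣ) : HypersurfaceRing n m l) = t := rfl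

/-- Evaluation at the coordinates `xᵢ`, `y`, `z`, `t`. -/
def coordVal {B : Type*} (bx : Fin n → B) (b₁ b₂ b₃ : B) : Coord n → B :=
  Sum.elim bx ![b₁, b₂, b₃]

section Lift

variable {B : Type*} [CommRing B] [Algebra ℂ B]

/-- The homomorphism out of the coordinate ring given by a point with values in `B`. -/
def lift (bx : Fin n → B) (b₁ b₂ b₃ : B)
    (h : b₃ ^ l * ((∏ i, bx i ^ 2) * b₂ - b₁ ^ m) = 1) : HypersurfaceRing n m l →ₐ[ℂ] B :=
  Ideal.Quotient.liftₐ (Ideal.span {equation n m l})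
      (MvPolynomial.aeval (coordVal bx b₁ b₂ b₃)) <| by
    intro a ha
    obtain ⟨c, rfl⟩ := Ideal.mem_span_singleton'.mp ha
    rw [map_mul]
    simp [equation, xVar, yVar, zVar, tVar, coordVal, h]

variable (bx : Fin n → B) (b₁ b₂ b₃ : B)
    (h : b₃ ^ l * ((∏ i, bx i ^ 2) * b₂ - b₁ ^ m) = 1)

theorem lift_mk (p : MvPolynomial (Coord n) ℂ) :
    lift bx b₁ b₂ b₃ h (mk n m l p) = MvPolynomial.aeval (coordVal bx b₁ b₂ b₃) p := rfl

@[simp]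
theorem lift_x (i : Fin n) : lift bx b₁ b₂ b₃ h (x i) = bx i := by
  simp [x, lift_mk, xVar, coordVal]

@[simp]
theorem lift_y : lift bx b₁ b₂ b₃ h y = b₁ := by simp [y, lift_mk, yVar, coordVal]

@[simp]
theorem lift_z : lift bx b₁ b₂ b₃ h z = b₂ := by simp [z, lift_mk, zVar, coordVal]

@[simp]
theorem lift_t : lift bx b₁ b₂ b₃ h t = b₃ := by simp [t, lift_mk, tVar, coordVal]

theorem algHom_ext {f g : HypersurfaceRing n m l →ₐ[ℂ] B} (hx : ∀ i, f (x i) = g (x i))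
    (hy : f y = g y) (hz : f z = g z) (ht : f t = g t) : f = g := by
  refine (AlgHom.cancel_right mk_surjective).mp (MvPolynomial.algHom_ext fun v => ?_)
  rcases v with i | v
  · exact hx i
  · fin_cases v
    exacts [hy, hz, ht]

end Lift

/-- The set of the coordinate functions. -/
def coords (n m l : ℕ) : Set (HypersurfaceRing n m l) := Set.range fun v => mk n m l (.X v)

theorem forall_mem_coords {p : HypersurfaceRing n m l → Prop} (hx : ∀ i, p (x i)) (hy : p y)
    (hz : p z) (ht : p t) : ∀ a ∈ coords n m l, p a := by
  rintro _ ⟨i | v, rfl⟩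
  · exact hx i
  · fin_cases v
    exacts [hy, hz, ht]

theorem finite_coords : (coords n m l).Finite := Set.finite_range _

theorem adjoin_coords : Algebra.adjoin ℂ (coords n m l) = ⊤ := by
  have h : coords n m l = mk n m l '' Set.range MvPolynomial.X := by
    rw [← Set.range_comp]
    rfl
  rw [h, ← AlgHom.map_adjoin, MvPolynomial.adjoin_range_X, Algebra.map_top,
    AlgHom.range_eq_top]
  exact mk_surjective

theorem subalgebra_eq_top {S : Subalgebra ℂ (HypersurfaceRing n m l)} (hx : ∀ i, x i ∈ S)
    (hy : y ∈ S) (hz : z ∈ S) (ht : t ∈ S) : S = ⊤ :=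
  top_le_iff.mp (adjoin_coords.ge.trans (Algebra.adjoin_le (forall_mem_coords hx hy hz ht)))

theorem derivation_ext {D D' : Derivation ℂ (HypersurfaceRing n m l) (HypersurfaceRing n m l)}
    (hx : ∀ i, D (x i) = D' (x i)) (hy : D y = D' y) (hz : D z = D' z) (ht : D t = D' t) :
    D = D' :=
  Derivation.ext_of_adjoin_eq_top _ adjoin_coords (forall_mem_coords hx hy hz ht)

section Base

/-- The Laurent polynomial ring `ℂ[x₁, …, xₙ][t, t⁻¹]`. -/
abbrev BaseRing (n : ℕ) : Type := (MvPolynomial (Fin n) ℂ)[T;T⁻¹]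

/-- The inclusion of `ℂ[x₁, …, xₙ][t, t⁻¹]` into the coordinate ring. -/
def ofBase (n m : ℕ) (hl : 1 ≤ l) : BaseRing n →ₐ[ℂ] HypersurfaceRing n m l :=
  laurentLift (MvPolynomial.aeval x) (unitOfT hl)

@[simp]
theorem ofBase_X (hl : 1 ≤ l) (i : Fin n) : ofBase n m hl (C (.X i)) = x i := by
  simp [ofBase]

@[simp]
theorem ofBase_C (hl : 1 ≤ l) (c : ℂ) :
    ofBase n m hl (C (.C c)) = algebraMap ℂ (HypersurfaceRing n m l) c := by
  simp [ofBase]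

@[simp]
theorem ofBase_T (hl : 1 ≤ l) (k : ℤ) :
    ofBase n m hl (T k) = ((unitOfT hl ^ k : (HypersurfaceRing n m l)ˣ) : _) := by
  simp [ofBase]

theorem C_X_ne_zero (i : Fin n) : (C (.X i) : BaseRing n) ≠ 0 := by
  intro h
  exact MvPolynomial.X_ne_zero (R := ℂ) i (by simpa using congrArg (fun p => p.coeff 0) h)

/-- The point of the hypersurface with `y = 0` over the generic point of the base. -/
def toFraction (n m : ℕ) (hm : 1 ≤ m) (l : ℕ) :
    HypersurfaceRing n m l →ₐ[ℂ] FractionRing (BaseRing n) :=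
  lift (fun i => algebraMap (BaseRing n) _ (C (.X i))) 0
    (algebraMap (BaseRing n) _ (T (-l)) *
      (∏ i, (algebraMap (BaseRing n) (FractionRing (BaseRing n)) (C (.X i))) ^ 2)⁻¹)
    (algebraMap (BaseRing n) _ (T 1)) <| by
    have hX : ∏ i : Fin n, (algebraMap (BaseRing n) (FractionRing (BaseRing n)) (C (.X i))) ^ 2
        ≠ 0 := by
      refine Finset.prod_ne_zero_iff.mpr fun i _ => pow_ne_zero _ ?_
      rw [Ne, map_eq_zero_iff _ (IsFractionRing.injective (BaseRing n) _)]
      exact C_X_ne_zero i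
    rw [zero_pow (by omega), sub_zero, mul_comm (algebraMap (BaseRing n) _ (T (-l))),
      mul_inv_cancel_left₀ hX, ← map_pow, ← map_mul, T_pow, ← T_add]
    simp

theorem toFraction_ofBase (hm : 1 ≤ m) (hl : 1 ≤ l) (p : BaseRing n) :
    toFraction n m hm l (ofBase n m hl p) = algebraMap _ _ p := by
  have h : (toFraction n m hm l).comp (ofBase n m hl) =
      IsScalarTower.toAlgHom ℂ (BaseRing n) (FractionRing (BaseRing n)) := by
    refine laurent_algHom_ext (fun a => ?_) ?_
    · refine DFunLike.congr_fun (f := ((toFraction n m hm l).comp (ofBase n m hl)).comp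
        (laurentC _)) (g := (IsScalarTower.toAlgHom ℂ (BaseRing n)
          (FractionRing (BaseRing n))).comp (laurentC _)) ?_ a
      refine MvPolynomial.algHom_ext fun i => ?_
      simp [toFraction]
    · simp [toFraction]
  exact DFunLike.congr_fun h p

theorem ofBase_injective (hm : 1 ≤ m) (hl : 1 ≤ l) : Function.Injective (ofBase n m hl) := by
  intro p q h
  apply IsFractionRing.injective (BaseRing n) (FractionRing (BaseRing n))
  rw [← toFraction_ofBase hm hl, ← toFraction_ofBase hm hl, h]

theorem x_ne_zero (hm : 1 ≤ m) (hl : 1 ≤ l) (i : Fin n) : (x i : HypersurfaceRing n m l) ≠ 0 := by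
  rw [← ofBase_X hl, Ne, map_eq_zero_iff _ (ofBase_injective hm hl)]
  exact C_X_ne_zero i

end Base

section Evaluation

/-- The restriction of regular functions to a parametrization `(x', z, τ)` of the divisor
`x_{i₀} = 0`: there `y = ζ τ ^ ℓ` and `t = τ ^ (-m)`, where `ζ ^ m = -1`. The value of `z` is
recorded by the variable with index `i₀`. -/
def evalDivisor (i₀ : Fin n) {ζ : ℂ} (hζ : ζ ^ m = -1) (l : ℕ) :
    HypersurfaceRing n m l →ₐ[ℂ] BaseRing n :=
  lift (fun i => if i = i₀ then 0 else C (.X i)) (C (.C ζ) * T l) (C (.X i₀)) (T (-m)) <| by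
    have hC : (C (.C ζ) : BaseRing n) ^ m = -1 := by
      rw [← map_pow, ← map_pow, hζ]
      simp
    have hT : (T (-m) : BaseRing n) ^ l * T l ^ m = 1 := by
      rw [T_pow, T_pow, ← T_add, ← T_zero]
      congr 1
      ring
    rw [Finset.prod_eq_zero (Finset.mem_univ i₀) (by simp), mul_pow, hC]
    linear_combination hT

variable (i₀ : Fin n) {ζ : ℂ} (hζ : ζ ^ m = -1)

@[simp]
theorem evalDivisor_x_self : evalDivisor i₀ hζ l (x i₀) = 0 := by simp [evalDivisor]

theorem evalDivisor_x_of_ne {i : Fin n} (hi : i ≠ i₀) :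
    evalDivisor i₀ hζ l (x i) = C (.X i) := by simp [evalDivisor, hi]

@[simp]
theorem evalDivisor_y : evalDivisor i₀ hζ l y = C (.C ζ) * T l := by simp [evalDivisor]

@[simp]
theorem evalDivisor_z : evalDivisor i₀ hζ l z = C (.X i₀) := by simp [evalDivisor]

@[simp]
theorem evalDivisor_t : evalDivisor i₀ hζ l t = T (-m) := by simp [evalDivisor]

@[simp]
theorem evalDivisor_xProd : evalDivisor i₀ hζ l xProd = 0 := by
  rw [xProd, map_prod]
  exact Finset.prod_eq_zero (Finset.mem_univ i₀) (by simp)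

theorem evalDivisor_unitOfT_zpow (hl : 1 ≤ l) (k : ℤ) :
    evalDivisor i₀ hζ l ((unitOfT hl ^ k : (HypersurfaceRing n m l)ˣ) : _) = T (-m * k) := by
  have h : Units.map (evalDivisor i₀ hζ l : HypersurfaceRing n m l →* BaseRing n) (unitOfT hl) =
      unitT _ ^ (-m : ℤ) := by
    ext1
    rw [val_unitT_zpow]
    simp
  have h2 := congrArg Units.val (congrArg (· ^ k) h)
  simp only [← map_zpow, ← zpow_mul, val_unitT_zpow, Units.coe_map] at h2
  exact h2

/-- As `ℓ` and `m` are coprime, `τ` is a monomial in `t` and `ζ⁻¹ y` on the divisor. -/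
theorem evalDivisor_surjective (hm : 1 ≤ m) (hl : 1 ≤ l) (hlm : Nat.Coprime l m) :
    Function.Surjective (evalDivisor i₀ hζ l) := by
  set S := (evalDivisor i₀ hζ l).range with hS
  have hζ0 : ζ ≠ 0 := by
    rintro rfl
    rw [zero_pow (by omega)] at hζ
    simp at hζ
  have hTm : ∀ k : ℤ, (T (m * k) : BaseRing n) ∈ S := fun k =>
    ⟨((unitOfT hl ^ (-k) : (HypersurfaceRing n m l)ˣ) : _), by
      change evalDivisor i₀ hζ l _ = _
      rw [evalDivisor_unitOfT_zpow]
      congr 1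
      ring⟩
  have hTl : (T l : BaseRing n) ∈ S := by
    refine ⟨algebraMap ℂ _ ζ⁻¹ * y, ?_⟩
    change evalDivisor i₀ hζ l _ = _
    rw [map_mul, AlgHom.commutes, evalDivisor_y, ← mul_assoc, LaurentPolynomial.algebraMap_apply,
      MvPolynomial.algebraMap_eq, ← map_mul, ← map_mul, inv_mul_cancel₀ hζ0]
    simp
  have hT : ∀ k : ℤ, (T k : BaseRing n) ∈ S := by
    have hlk : ∀ k : ℕ, (T (l * k) : BaseRing n) ∈ S := fun k => by
      have := pow_mem hTl k
      rwa [T_pow, mul_comm] at this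
    have hb := Int.isCoprime_iff_gcd_eq_one.mpr (show Int.gcd l m = 1 from hlm)
    obtain ⟨a, b, hab⟩ := hb
    intro k
    have hm0 : (m : ℤ) ≠ 0 := by omega
    have hmul := mul_mem (hlk ((k * a) % m).toNat) (hTm (l * ((k * a) / m) + k * b))
    rw [← T_add, Int.toNat_of_nonneg (Int.emod_nonneg _ hm0)] at hmul
    convert hmul using 2
    have := Int.emod_add_mul_ediv (k * a) m
    linear_combination (-k) * hab - l * this
  have hX : ∀ i, (C (.X i) : BaseRing n) ∈ S := fun i => by
    by_cases hi : i = i₀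
    · exact ⟨z, by rw [hi]; exact evalDivisor_z i₀ hζ⟩
    · exact ⟨x i, evalDivisor_x_of_ne i₀ hζ hi⟩
  have hC : ∀ p, (C p : BaseRing n) ∈ S := fun p => by
    have h1 : (⊤ : Subalgebra ℂ (MvPolynomial (Fin n) ℂ)) ≤ S.comap (laurentC _) := by
      rw [← MvPolynomial.adjoin_range_X, Algebra.adjoin_le_iff]
      rintro _ ⟨i, rfl⟩
      exact hX i
    exact h1 Algebra.mem_top
  intro p
  change p ∈ S
  induction p using LaurentPolynomial.induction_on' with
  | add p q hp hq => exact add_mem hp hq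
  | C_mul_T k a => exact mul_mem (hC a) (hT k)

end Evaluation

end HypersurfaceRing

end Ring

/-! ### Cylinders, factoriality and dimension -/

noncomputable section Cylinder

namespace HypersurfaceRing

open LaurentPolynomial

variable {n m l : ℕ}

section Complement

/-- The polynomial `x₁² ⋯ xₙ² z - y ^ m` in the variables `x₁, …, xₙ, y, z`. -/
def divisorPoly (n m : ℕ) : MvPolynomial (Fin n ⊕ Fin 2) ℂ :=
  (∏ i : Fin n, .X (Sum.inl i) ^ 2) * .X (Sum.inr 1) - .X (Sum.inr 0) ^ m

theorem divisorPoly_ne_zero (n m : ℕ) : divisorPoly n m ≠ 0 := by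
  intro h
  have h1 := congrArg (MvPolynomial.aeval (Sum.elim 1 ![1, 0] : Fin n ⊕ Fin 2 → ℂ)) h
  have h2 := congrArg (MvPolynomial.aeval (Sum.elim 1 ![1, 2] : Fin n ⊕ Fin 2 → ℂ)) h
  simp [divisorPoly] at h1 h2

theorem map_divisorPoly {S : Type*} [CommRing S] (φ : MvPolynomial (Fin n ⊕ Fin 2) ℂ →+* S) :
    φ (divisorPoly n m) = (∏ i : Fin n, φ (.X (Sum.inl i)) ^ 2) * φ (.X (Sum.inr 1)) -
      φ (.X (Sum.inr 0)) ^ m := by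
  simp [divisorPoly]

/-- For `ℓ = 1` the hypersurface is the complement of a divisor in an affine space. -/
def equivAway (n m : ℕ) :
    HypersurfaceRing n m 1 ≃ₐ[ℂ] Localization.Away (divisorPoly n m) :=
  let f := divisorPoly n m
  let ι := algebraMap (MvPolynomial (Fin n ⊕ Fin 2) ℂ) (Localization.Away f)
  let F : HypersurfaceRing n m 1 →ₐ[ℂ] Localization.Away f :=
    lift (fun i => ι (.X (Sum.inl i))) (ι (.X (Sum.inr 0))) (ι (.X (Sum.inr 1)))
      (IsLocalization.Away.invSelf f) (by
        rw [pow_one, ← map_divisorPoly, mul_comm]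
        exact IsLocalization.Away.mul_invSelf f)
  let g : MvPolynomial (Fin n ⊕ Fin 2) ℂ →ₐ[ℂ] HypersurfaceRing n m 1 :=
    MvPolynomial.aeval (Sum.elim x ![y, z])
  have hg : g f = (∏ i, x i ^ 2) * z - y ^ m := by simp [g, f, divisorPoly]
  have hgu : t * g f = 1 := by
    rw [hg, ← relation (n := n) (m := m) (l := 1), pow_one]
  let G : Localization.Away f →ₐ[ℂ] HypersurfaceRing n m 1 :=
    IsLocalization.liftAlgHom (M := Submonoid.powers f) (f := g) (by
      rintro ⟨_, k, rfl⟩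
      rw [map_pow]
      exact (IsUnit.of_mul_eq_one_right _ hgu).pow k)
  have hG : ∀ p, G (ι p) = g p := fun p => by
    simp [G, ι]
  AlgEquiv.ofAlgHom F G
    (by
      refine IsLocalization.algHom_ext (W := Submonoid.powers f) ?_
      refine MvPolynomial.algHom_ext fun v => ?_
      change F (G (ι _)) = ι _
      rw [hG]
      rcases v with i | v
      · simp [F, g]
      · fin_cases v <;> simp [F, g])
    (by
      refine algHom_ext (fun i => ?_) ?_ ?_ ?_
      · change G (F _) = _
        simp only [F, lift_x, hG]
        simp [g]
      · change G (F _) = _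
        simp only [F, lift_y, hG]
        simp [g]
      · change G (F _) = _
        simp only [F, lift_z, hG]
        simp [g]
      · change G (F _) = t
        simp only [F, lift_t]
        have h1 : G (IsLocalization.Away.invSelf f) * g f = 1 := by
          rw [← hG, ← map_mul, mul_comm, IsLocalization.Away.mul_invSelf, map_one]
        calc G (IsLocalization.Away.invSelf f)
            _ = G (IsLocalization.Away.invSelf f) * (t * g f) := by rw [hgu, mul_one]
            _ = t * (G (IsLocalization.Away.invSelf f) * g f) := by ring
            _ = t := by rw [h1, mul_one])

theorem powers_divisorPoly_le (n m : ℕ) :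
    Submonoid.powers (divisorPoly n m) ≤ nonZeroDivisors _ :=
  powers_le_nonZeroDivisors_of_noZeroDivisors (divisorPoly_ne_zero n m)

instance isDomain_one (n m : ℕ) : IsDomain (HypersurfaceRing n m 1) :=
  have : IsDomain (Localization.Away (divisorPoly n m)) :=
    IsLocalization.isDomain_localization (powers_divisorPoly_le n m)
  (equivAway n m).toMulEquiv.isDomain

instance uniqueFactorizationMonoid_one (n m : ℕ) :
    UniqueFactorizationMonoid (HypersurfaceRing n m 1) :=
  have : IsDomain (Localization.Away (divisorPoly n m)) :=
    IsLocalization.isDomain_localization (powers_divisorPoly_le n m)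
  have := uniqueFactorizationMonoid_of_isLocalization (powers_divisorPoly_le n m)
    (Localization.Away (divisorPoly n m))
  (equivAway n m).symm.toMulEquiv.uniqueFactorizationMonoid this

end Complement

section Twist

variable {B : Type*} [CommRing B]

/-- The weighted scaling `(y, z) ↦ (c y, c ^ m z)` multiplies `x₁² ⋯ xₙ² z - y ^ m` by `c ^ m`. -/
theorem twist_relation {l' : ℕ} {bx : Fin n → B} {b₁ b₂ : B} {τ τ' c : Bˣ}
    (h : (τ : B) ^ l * ((∏ i, bx i ^ 2) * b₂ - b₁ ^ m) = 1) (hc : τ' ^ l' * c ^ m = τ ^ l) :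
    (τ' : B) ^ l' * ((∏ i, bx i ^ 2) * (b₂ * (c : B) ^ m) - (b₁ * c) ^ m) = 1 := by
  have hc' : (τ' : B) ^ l' * (c : B) ^ m = (τ : B) ^ l := by
    simpa using congrArg Units.val hc
  rw [mul_pow]
  linear_combination h + ((∏ i, bx i ^ 2) * b₂ - b₁ ^ m) * hc'

variable [Algebra ℂ B]

theorem cylinder_algHom_ext {f g : (HypersurfaceRing n m l)[T;T⁻¹] →ₐ[ℂ] B}
    (hx : ∀ i, f (C (x i)) = g (C (x i))) (hy : f (C y) = g (C y)) (hz : f (C z) = g (C z))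
    (ht : f (C t) = g (C t)) (hT : f (T 1) = g (T 1)) : f = g := by
  refine laurent_algHom_ext (fun a => ?_) hT
  exact DFunLike.congr_fun (algHom_ext (f := f.comp (laurentC _)) (g := g.comp (laurentC _))
    hx hy hz ht) a

/-- A homomorphism from `A[u, u⁻¹]`, where `A` is the coordinate ring of the hypersurface with
exponent `ℓ`, is given by a point of the hypersurface with exponent `ℓ'`, a scaling factor `c` of
that point, and the image `υ` of `u`. -/
theorem exists_cylinderLift (l : ℕ) {l' : ℕ} {bx : Fin n → B} {b₁ b₂ : B} {τ : Bˣ}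
    (h : (τ : B) ^ l' * ((∏ i, bx i ^ 2) * b₂ - b₁ ^ m) = 1) (τ' c υ : Bˣ)
    (hc : τ' ^ l * c ^ m = τ ^ l') :
    ∃ F : (HypersurfaceRing n m l)[T;T⁻¹] →ₐ[ℂ] B, (∀ i, F (C (x i)) = bx i) ∧
      F (C y) = b₁ * c ∧ F (C z) = b₂ * (c : B) ^ m ∧ F (C t) = τ' ∧ F (T 1) = υ :=
  ⟨laurentLift (lift bx (b₁ * c) (b₂ * (c : B) ^ m) τ' (twist_relation h hc)) υ, by simp⟩

/-- The function `t` as a unit of the coordinate ring of the cylinder. -/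
def cylinderT (n m : ℕ) (hl : 1 ≤ l) : (HypersurfaceRing n m l)[T;T⁻¹]ˣ :=
  Units.map (C (R := HypersurfaceRing n m l)).toMonoidHom (unitOfT hl)

theorem val_cylinderT (hl : 1 ≤ l) :
    (cylinderT n m hl : (HypersurfaceRing n m l)[T;T⁻¹]) = C t := rfl

theorem relation_C (hl : 1 ≤ l) :
    (cylinderT n m hl : (HypersurfaceRing n m l)[T;T⁻¹]) ^ l *
      ((∏ i, (C (x i)) ^ 2) * C z - C y ^ m) = 1 := by
  rw [val_cylinderT]
  have h := congrArg (C : HypersurfaceRing n m l → _) (relation (n := n) (m := m) (l := l))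
  simpa only [map_mul, map_sub, map_pow, map_prod, map_one] using h

/-- The monomial change of coordinates of the torus with exponents `(a b; c d)`. -/
theorem monomial_mul {M : Type*} [CommGroup M] (u v : M) (a b c d r s : ℤ) :
    (u ^ a * v ^ b) ^ r * (u ^ c * v ^ d) ^ s = u ^ (a * r + c * s) * v ^ (b * r + d * s) := by
  rw [mul_zpow, mul_zpow, ← zpow_mul, ← zpow_mul, ← zpow_mul, ← zpow_mul, zpow_add, zpow_add,
    mul_mul_mul_comm]

/-- The cylinder over the hypersurface with exponent `ℓ` is the cylinder over the one with
exponent `1`: since `ℓ` and `m` are coprime, `t ^ ℓ u ^ m` is part of a system of coordinates on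
the torus with coordinates `t`, `u`. -/
theorem nonempty_cylinderEquiv (n m : ℕ) (hl : 1 ≤ l) (hlm : Nat.Coprime l m) :
    Nonempty ((HypersurfaceRing n m l)[T;T⁻¹] ≃ₐ[ℂ] (HypersurfaceRing n m 1)[T;T⁻¹]) := by
  obtain ⟨q, p', hpq⟩ := Int.isCoprime_iff_gcd_eq_one.mpr (show Int.gcd l m = 1 from hlm)
  obtain ⟨p, rfl⟩ : ∃ p, p' = -p := ⟨-p', by ring⟩
  set τ := cylinderT n m hl with hτ
  set υ := unitT (HypersurfaceRing n m l) with hυ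
  set σ := cylinderT n m le_rfl with hσ
  set ω := unitT (HypersurfaceRing n m 1) with hω
  have hcF : (τ ^ (l : ℤ) * υ ^ (m : ℤ)) ^ 1 * (υ ^ (-1 : ℤ)) ^ m = τ ^ l := by
    rw [pow_one, zpow_natCast, zpow_natCast, zpow_neg_one, inv_pow, mul_inv_cancel_right]
  have hcG : (σ ^ q * ω ^ (-m : ℤ)) ^ l * (σ ^ (-p) * ω ^ (l : ℤ)) ^ m = σ ^ 1 := by
    rw [← zpow_natCast _ l, ← zpow_natCast _ m, monomial_mul,
      show q * l + -p * m = 1 by linear_combination hpq,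
      show (-m : ℤ) * l + l * m = 0 by ring, zpow_zero, mul_one, zpow_one, pow_one]
  obtain ⟨F, hFx, hFy, hFz, hFt, hFT⟩ :=
    exists_cylinderLift 1 (relation_C (n := n) (m := m) hl) _ _ (τ ^ p * υ ^ q) hcF
  obtain ⟨G, hGx, hGy, hGz, hGt, hGT⟩ :=
    exists_cylinderLift l (relation_C (n := n) (m := m) le_rfl) _ _ (σ ^ (-p) * ω ^ (l : ℤ)) hcG
  let Fu := Units.map (F : (HypersurfaceRing n m 1)[T;T⁻¹] →* (HypersurfaceRing n m l)[T;T⁻¹])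
  let Gu := Units.map (G : (HypersurfaceRing n m l)[T;T⁻¹] →* (HypersurfaceRing n m 1)[T;T⁻¹])
  have hF : ∀ w, F (Units.val w) = (Fu w).val := fun w => rfl
  have hG : ∀ w, G (Units.val w) = (Gu w).val := fun w => rfl
  have hFσ : Fu σ = τ ^ (l : ℤ) * υ ^ (m : ℤ) := Units.ext hFt
  have hFω : Fu ω = τ ^ p * υ ^ q := Units.ext hFT
  have hGτ : Gu τ = σ ^ q * ω ^ (-m : ℤ) := Units.ext hGt
  have hGυ : Gu υ = σ ^ (-p) * ω ^ (l : ℤ) := Units.ext hGT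
  -- each of the two scaling factors is sent to the inverse of the other one
  have hGc : Gu (υ ^ (-1 : ℤ)) = (σ ^ (-p) * ω ^ (l : ℤ))⁻¹ := by
    rw [map_zpow, hGυ, zpow_neg_one]
  have hFc : Fu (σ ^ (-p) * ω ^ (l : ℤ)) = (υ ^ (-1 : ℤ))⁻¹ := by
    rw [map_mul, map_zpow, map_zpow, hFσ, hFω, monomial_mul,
      show (l : ℤ) * -p + p * l = 0 by ring,
      show (m : ℤ) * -p + q * l = 1 by linear_combination hpq]
    simp
  clear_value Fu Gu τ υ σ ω
  refine ⟨AlgEquiv.ofAlgHom G F ?_ ?_⟩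
  · refine cylinder_algHom_ext (fun i => ?_) ?_ ?_ ?_ ?_
    · rw [AlgHom.comp_apply, hFx, hGx, AlgHom.id_apply]
    · rw [AlgHom.comp_apply, hFy, map_mul, hGy, hG, hGc, Units.mul_inv_cancel_right,
        AlgHom.id_apply]
    · rw [AlgHom.comp_apply, hFz, map_mul, map_pow, hGz, hG, hGc, mul_assoc, ← mul_pow,
        Units.mul_inv, one_pow, mul_one, AlgHom.id_apply]
    · rw [AlgHom.comp_apply, ← val_cylinderT le_rfl, ← hσ, hF, hFσ, hG,
        map_mul, map_zpow, map_zpow, hGτ, hGυ, monomial_mul,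
        show q * l + -p * m = 1 by linear_combination hpq,
        show (-m : ℤ) * l + l * m = 0 by ring]
      simp
    · rw [AlgHom.comp_apply, ← val_unitT, ← hω, hF, hFω, hG, map_mul, map_zpow, map_zpow, hGτ,
        hGυ, monomial_mul,
        show q * p + -p * q = 0 by ring,
        show (-m : ℤ) * p + l * q = 1 by linear_combination hpq]
      simp
  · refine cylinder_algHom_ext (fun i => ?_) ?_ ?_ ?_ ?_
    · rw [AlgHom.comp_apply, hGx, hFx, AlgHom.id_apply]
    · rw [AlgHom.comp_apply, hGy, map_mul, hFy, hF, hFc, Units.mul_inv_cancel_right,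
        AlgHom.id_apply]
    · rw [AlgHom.comp_apply, hGz, map_mul, map_pow, hFz, hF, hFc, mul_assoc, ← mul_pow,
        Units.mul_inv, one_pow, mul_one, AlgHom.id_apply]
    · rw [AlgHom.comp_apply, ← val_cylinderT hl, ← hτ, hG, hGτ, hF,
        map_mul, map_zpow, map_zpow, hFσ, hFω, monomial_mul,
        show (l : ℤ) * q + p * (-m) = 1 by linear_combination hpq,
        show (m : ℤ) * q + q * (-m) = 0 by ring]
      simp
    · rw [AlgHom.comp_apply, ← val_unitT, ← hυ, hG, hGυ, hF, map_mul, map_zpow, map_zpow, hFσ,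
        hFω, monomial_mul,
        show (l : ℤ) * -p + p * l = 0 by ring,
        show (m : ℤ) * -p + q * l = 1 by linear_combination hpq]
      simp

end Twist

theorem isDomain (n m : ℕ) (hl : 1 ≤ l) (hlm : Nat.Coprime l m) :
    IsDomain (HypersurfaceRing n m l) := by
  obtain ⟨e⟩ := nonempty_cylinderEquiv n m hl hlm
  have : IsDomain (HypersurfaceRing n m l)[T;T⁻¹] := e.toMulEquiv.isDomain
  exact isDomain_of_isDomain_laurent

theorem uniqueFactorizationMonoid (n m : ℕ) (hl : 1 ≤ l) (hlm : Nat.Coprime l m) :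
    UniqueFactorizationMonoid (HypersurfaceRing n m l) := by
  obtain ⟨e⟩ := nonempty_cylinderEquiv n m hl hlm
  have := isDomain n m hl hlm
  have e' : (HypersurfaceRing n m 1)[T;T⁻¹] ≃* (HypersurfaceRing n m l)[T;T⁻¹] :=
    e.symm.toMulEquiv
  have : UniqueFactorizationMonoid (HypersurfaceRing n m l)[T;T⁻¹] :=
    MulEquiv.uniqueFactorizationMonoid e'
      (uniqueFactorizationMonoid_laurent (HypersurfaceRing n m 1))
  exact uniqueFactorizationMonoid_of_laurent

section Dimension

theorem ringKrullDim_baseRing_ge (n : ℕ) :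
    ((n + 1 : ℕ) : WithBot ℕ∞) ≤ ringKrullDim (BaseRing n) := by
  let f : BaseRing n →+* MvPolynomial (Fin n) ℂ := eval₂ (RingHom.id _) 1
  have hf : Function.Surjective f := fun p => ⟨C p, by simp [f]⟩
  have hT : (T 1 - 1 : BaseRing n) ≠ 0 := by
    intro h
    have := congrArg (fun p => p.coeff 0) (sub_eq_zero.mp h)
    rw [← T_zero] at this
    simp at this
  have h1 := ringKrullDim_quotient_succ_le_of_nonZeroDivisor (mem_nonZeroDivisors_of_ne_zero hT)
  let g : BaseRing n ⧸ Ideal.span {(T 1 - 1 : BaseRing n)} →+* MvPolynomial (Fin n) ℂ :=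
    Ideal.Quotient.lift _ f (fun a ha => by
      obtain ⟨c, rfl⟩ := Ideal.mem_span_singleton'.mp ha
      simp [f])
  have hg : Function.Surjective g := Ideal.Quotient.lift_surjective_of_surjective _ _ hf
  have h2 : ringKrullDim (MvPolynomial (Fin n) ℂ) ≤
      ringKrullDim (BaseRing n ⧸ Ideal.span {(T 1 - 1 : BaseRing n)}) :=
    ringKrullDim_le_of_surjective g hg
  rw [MvPolynomial.ringKrullDim_of_isNoetherianRing, ringKrullDim_eq_zero_of_field,
    zero_add, Nat.card_fin] at h2
  push_cast
  exact (add_le_add_left h2 1).trans h1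

/-- The dimension exceeds that of the divisor `x₁ = 0`, whose coordinate ring maps onto the Laurent
polynomial ring in `n + 1` variables. -/
theorem ringKrullDim_ge (hn : 1 ≤ n) (hm : 1 ≤ m) (hl : 1 ≤ l) (hlm : Nat.Coprime l m) :
    ((n + 2 : ℕ) : WithBot ℕ∞) ≤ ringKrullDim (HypersurfaceRing n m l) := by
  have := isDomain n m hl hlm
  obtain ⟨ζ, hζ⟩ := IsAlgClosed.exists_pow_nat_eq (-1 : ℂ) (n := m) (by omega)
  let i₀ : Fin n := ⟨0, by omega⟩
  have h1 := ringKrullDim_quotient_succ_le_of_nonZeroDivisor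
    (mem_nonZeroDivisors_of_ne_zero (x_ne_zero (n := n) hm hl i₀))
  let g : HypersurfaceRing n m l ⧸ Ideal.span {(x i₀ : HypersurfaceRing n m l)} →+* BaseRing n :=
    Ideal.Quotient.lift _ (evalDivisor i₀ hζ l : HypersurfaceRing n m l →+* BaseRing n)
      (fun a ha => by
        obtain ⟨c, rfl⟩ := Ideal.mem_span_singleton'.mp ha
        simp)
  have hg : Function.Surjective g := Ideal.Quotient.lift_surjective_of_surjective _ _
    (evalDivisor_surjective i₀ hζ hm hl hlm)
  have h2 : ringKrullDim (BaseRing n) ≤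
      ringKrullDim (HypersurfaceRing n m l ⧸ Ideal.span {(x i₀ : HypersurfaceRing n m l)}) :=
    ringKrullDim_le_of_surjective g hg
  replace h2 := (ringKrullDim_baseRing_ge n).trans h2
  refine le_trans ?_ ((add_le_add_left h2 1).trans h1)
  push_cast
  rw [add_assoc]
  norm_num

theorem equation_ne_zero (n m : ℕ) (hl : 1 ≤ l) : equation n m l ≠ 0 := by
  intro h
  have h1 := congrArg (MvPolynomial.aeval (0 : Coord n → ℂ)) h
  simp [equation, tVar, zero_pow (by omega : l ≠ 0)] at h1

theorem ringKrullDim_le (n m : ℕ) (hl : 1 ≤ l) :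
    ringKrullDim (HypersurfaceRing n m l) ≤ ((n + 2 : ℕ) : WithBot ℕ∞) := by
  have h1 := ringKrullDim_quotient_succ_le_of_nonZeroDivisor
    (mem_nonZeroDivisors_of_ne_zero (equation_ne_zero n m hl))
  change ringKrullDim (HypersurfaceRing n m l) + 1 ≤ _ at h1
  rw [MvPolynomial.ringKrullDim_of_isNoetherianRing, ringKrullDim_eq_zero_of_field,
    zero_add, Nat.card_sum, Nat.card_fin, Nat.card_fin] at h1
  exact ENat.WithBot.lt_add_one_iff.mp (ENat.WithBot.add_one_le_natCast_iff.mp h1)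

end Dimension

end HypersurfaceRing

end Cylinder

/-! ### Locally nilpotent derivations annihilate the `xᵢ` -/

noncomputable section MakarLimanov

namespace HypersurfaceRing

variable {n m l : ℕ}

section Grading

attribute [local instance] MvPolynomial.weightedGradedAlgebra

/-- The weights of the coordinates: `-1` for `x_{i₀}`, `2` for `z`, and `0` for all others. -/
def weight (i₀ : Fin n) : Coord n → ℤ :=
  Sum.elim (fun i => if i = i₀ then -1 else 0) ![0, 2, 0]

theorem weight_apply (i₀ : Fin n) (d : Coord n →₀ ℕ) :
    Finsupp.weight (weight i₀) d = 2 * (d (Sum.inr 1) : ℤ) - d (Sum.inl i₀) := by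
  rw [Finsupp.weight_apply, Finsupp.sum_fintype _ _ (by simp), Fintype.sum_sum_type,
    Fin.sum_univ_three]
  simp [weight]
  ring

theorem isWeightedHomogeneous_equation (i₀ : Fin n) :
    (equation n m l).IsWeightedHomogeneous (weight i₀) 0 := by
  have hx : ∀ i : Fin n, (xVar i).IsWeightedHomogeneous (weight i₀) (if i = i₀ then -1 else 0) :=
    fun i => MvPolynomial.isWeightedHomogeneous_X ℂ (weight i₀) (Sum.inl i)
  have hy : (yVar n).IsWeightedHomogeneous (weight i₀) 0 :=
    MvPolynomial.isWeightedHomogeneous_X ℂ (weight i₀) (Sum.inr 0)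
  have hz : (zVar n).IsWeightedHomogeneous (weight i₀) 2 :=
    MvPolynomial.isWeightedHomogeneous_X ℂ (weight i₀) (Sum.inr 1)
  have ht : (tVar n).IsWeightedHomogeneous (weight i₀) 0 :=
    MvPolynomial.isWeightedHomogeneous_X ℂ (weight i₀) (Sum.inr 2)
  have hX := MvPolynomial.IsWeightedHomogeneous.prod Finset.univ (fun i => xVar i ^ 2) _
    (fun i _ => (hx i).pow 2)
  have hXz := hX.mul hz
  have hdeg : ∑ i : Fin n, 2 • (if i = i₀ then (-1 : ℤ) else 0) + 2 = 0 := by simp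
  rw [hdeg] at hXz
  have hym := hy.pow m
  rw [smul_zero] at hym
  have htl := (ht.pow l).mul (hXz.sub hym)
  rw [smul_zero, add_zero] at htl
  exact htl.sub (MvPolynomial.isWeightedHomogeneous_one ℂ (weight i₀))

/-- The homogeneous components of the coordinate ring for the grading by `weight`. -/
def grading (m l : ℕ) (i₀ : Fin n) : ℤ → Submodule ℂ (HypersurfaceRing n m l) :=
  imageGrading (MvPolynomial.weightedHomogeneousSubmodule ℂ (weight i₀)) (mk n m l)

instance gradedAlgebra (i₀ : Fin n) : GradedAlgebra (grading m l i₀) := by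
  refine imageGradedAlgebra _ mk_surjective ?_
  have hker : RingHom.ker (mk n m l) = Ideal.span {equation n m l} :=
    Ideal.Quotient.mkₐ_ker ℂ (Ideal.span {equation n m l})
  rw [hker]
  refine Ideal.homogeneous_span _ _ ?_
  rintro _ rfl
  exact ⟨0, isWeightedHomogeneous_equation i₀⟩

theorem X_dvd_of_forall_support {v : Coord n} {p : MvPolynomial (Coord n) ℂ}
    (h : ∀ d ∈ p.support, d v ≠ 0) : MvPolynomial.X v ∣ p := by
  rw [p.as_sum]
  exact Finset.dvd_sum fun d hd => MvPolynomial.X_dvd_monomial.mpr (Or.inr (h d hd))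

/-- Elements of positive weight are divisible by `z`, the only coordinate of positive weight. -/
theorem z_dvd_of_mem_grading {i₀ : Fin n} {i : ℤ} (hi : 1 ≤ i) {a : HypersurfaceRing n m l}
    (ha : a ∈ grading m l i₀ i) : z ∣ a := by
  obtain ⟨p, hp, rfl⟩ := ha
  refine map_dvd (mk n m l) (X_dvd_of_forall_support fun d hd h0 => ?_)
  have h1 := hp (MvPolynomial.mem_support_iff.mp hd)
  rw [weight_apply, h0] at h1
  push_cast at h1
  omega

/-- Elements of negative weight are divisible by `x_{i₀}`, the only coordinate of negative
weight. -/
theorem x_dvd_of_mem_grading {i₀ : Fin n} {i : ℤ} (hi : i ≤ -1) {a : HypersurfaceRing n m l}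
    (ha : a ∈ grading m l i₀ i) : x i₀ ∣ a := by
  obtain ⟨p, hp, rfl⟩ := ha
  refine map_dvd (mk n m l) (X_dvd_of_forall_support fun d hd h0 => ?_)
  have h1 := hp (MvPolynomial.mem_support_iff.mp hd)
  rw [weight_apply, h0] at h1
  push_cast at h1
  omega

theorem mk_X_mem_grading (i₀ : Fin n) (v : Coord n) :
    mk n m l (.X v) ∈ grading m l i₀ (weight i₀ v) :=
  ⟨_, MvPolynomial.isWeightedHomogeneous_X ℂ (weight i₀) v, rfl⟩

theorem x_mem_grading (i₀ : Fin n) : (x i₀ : HypersurfaceRing n m l) ∈ grading m l i₀ (-1) := by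
  have h : weight i₀ (Sum.inl i₀) = -1 := by simp [weight]
  rw [← h]
  exact mk_X_mem_grading i₀ (Sum.inl i₀)

theorem z_mem_grading (i₀ : Fin n) : (z : HypersurfaceRing n m l) ∈ grading m l i₀ 2 :=
  mk_X_mem_grading (m := m) (l := l) i₀ (Sum.inr 1)

end Grading

section Kernel

variable {D : Derivation ℂ (HypersurfaceRing n m l) (HypersurfaceRing n m l)}

theorem z_ne_zero (hm : 1 ≤ m) : (z : HypersurfaceRing n m l) ≠ 0 := by
  intro h
  have h1 := congrArg (lift (l := l) (m := m) (fun _ : Fin n => (1 : ℂ)) 0 1 1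
    (by simp [zero_pow (by omega : m ≠ 0)])) h
  simp at h1

theorem xProd_sq_mul_z_derivation (ht : D t = 0) (hl : 1 ≤ l) :
    D (xProd ^ 2 * z) = (m : HypersurfaceRing n m l) * y ^ (m - 1) * D y := by
  have h := congrArg D (relation' (n := n) (m := m) (l := l))
  rw [Derivation.leibniz, Derivation.leibniz_pow, ht, smul_zero, smul_zero, smul_zero, add_zero,
    Derivation.map_one_eq_zero, map_sub, Derivation.leibniz_pow, smul_eq_mul] at h
  have h2 := (((isUnit_t hl).pow l).mul_right_eq_zero).mp h
  rw [sub_eq_zero] at h2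
  rw [h2]
  simp only [smul_eq_mul, nsmul_eq_mul]
  ring

/-- If `u` divides the derivative of `x₁² ⋯ xₙ² z` and `x₁² ⋯ xₙ² z` itself, then it divides
the derivative of `y`, because `y` is a unit modulo `x₁² ⋯ xₙ² z`. -/
theorem dvd_derivation_y (hm : 1 ≤ m) (hl : 1 ≤ l) (ht : D t = 0) {u : HypersurfaceRing n m l}
    (hu : u ∣ xProd ^ 2 * z) (hDu : u ∣ D (xProd ^ 2 * z)) : u ∣ D y := by
  have h1 : (m : HypersurfaceRing n m l) * D y =
      t ^ l * ((m : HypersurfaceRing n m l) * D y * (xProd ^ 2 * z) - y * D (xProd ^ 2 * z)) := by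
    rw [xProd_sq_mul_z_derivation ht hl]
    obtain ⟨r, rfl⟩ := Nat.exists_eq_add_of_le' hm
    rw [Nat.add_sub_cancel]
    linear_combination -((r + 1 : ℕ) : HypersurfaceRing n (r + 1) l) * D y *
      relation' (n := n) (m := r + 1) (l := l)
  have h2 : u ∣ (m : HypersurfaceRing n m l) * D y := by
    rw [h1]
    exact ((hu.mul_left _).sub (hDu.mul_left _)).mul_left _
  have hmu : IsUnit (m : HypersurfaceRing n m l) := by
    have h3 : IsUnit (m : ℂ) := (Nat.cast_ne_zero.mpr (by omega)).isUnit
    simpa using h3.map (algebraMap ℂ (HypersurfaceRing n m l))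
  exact (hmu.dvd_mul_left).mp h2

variable [IsDomain (HypersurfaceRing n m l)]

theorem xProd_ne_zero (hm : 1 ≤ m) (hl : 1 ≤ l) : (xProd : HypersurfaceRing n m l) ≠ 0 :=
  Finset.prod_ne_zero_iff.mpr fun i _ => x_ne_zero hm hl i

/-- The function `z` is not in the kernel of a nonzero locally nilpotent derivation. This is where
the exponents `2` of the `xᵢ` matter: they give `deg (x₁ ⋯ xₙ) < deg y`, whereas the equation
gives `2 deg (x₁ ⋯ xₙ) = m deg y` if `z` has degree `0`. -/
theorem derivation_z_ne_zero (hm : 2 ≤ m) (hl : 1 ≤ l) (hD : IsLocallyNilpotent D) (hD0 : D ≠ 0) :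
    D z ≠ 0 := by
  intro hz
  have ht : D t = 0 := apply_eq_zero_of_isUnit hD (isUnit_t hl)
  have hX0 : (xProd : HypersurfaceRing n m l) ≠ 0 := xProd_ne_zero (by omega) hl
  have hz0 : (z : HypersurfaceRing n m l) ≠ 0 := z_ne_zero (by omega)
  have hXz : (xProd ^ 2 * z : HypersurfaceRing n m l) ≠ 0 := mul_ne_zero (pow_ne_zero 2 hX0) hz0
  have hdvd : xProd ∣ D y := by
    refine dvd_derivation_y (by omega) hl ht ⟨xProd * z, by ring⟩ ?_
    rw [Derivation.leibniz, hz, smul_zero, zero_add, Derivation.leibniz_pow]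
    simp only [smul_eq_mul, nsmul_eq_mul]
    exact ⟨2 * z * D xProd, by norm_num; ring⟩
  have hy : D y = 0 := by
    by_contra hy
    have h1 := lndDegree_le_of_dvd hD hy hdvd
    rw [lndDegree_apply] at h1
    have h2 : lndDegree D hD (y : HypersurfaceRing n m l) ≠ 0 :=
      fun h => hy ((lndDegree_eq_zero_iff hD).mp h)
    have h3 : (xProd ^ 2 * z : HypersurfaceRing n m l) =
        y ^ m + (((unitOfT hl ^ l)⁻¹ : (HypersurfaceRing n m l)ˣ) : HypersurfaceRing n m l) := by
      rw [← sub_eq_iff_eq_add', ← Units.mul_right_inj (unitOfT hl ^ l), Units.mul_inv]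
      simpa using relation'
    have h4 := congrArg (lndDegree D hD) h3
    rw [lndDegree_mul hD (pow_ne_zero 2 hX0) hz0, lndDegree_pow,
      (lndDegree_eq_zero_iff hD).mpr hz, add_zero,
      lndDegree_add_of_apply_eq_zero hD (apply_eq_zero_of_isUnit hD (Units.isUnit _)),
      lndDegree_pow] at h4
    have h5 : 2 * lndDegree D hD (y : HypersurfaceRing n m l) ≤
        m * lndDegree D hD (y : HypersurfaceRing n m l) := Nat.mul_le_mul_right _ hm
    omega
  refine hD0 (derivation_ext (fun i => ?_) hy hz ht)
  refine apply_eq_zero_of_dvd hD hXz ?_ ?_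
  · exact ((Finset.dvd_prod_of_mem _ (Finset.mem_univ i)).pow (by norm_num)).mul_right z
  · rw [xProd_sq_mul_z_derivation ht hl, hy, mul_zero]

/-- Every locally nilpotent derivation annihilates the `xᵢ`. -/
theorem derivation_x_eq_zero (hm : 2 ≤ m) (hl : 1 ≤ l) (hD : IsLocallyNilpotent D) (i₀ : Fin n) :
    D (x i₀) = 0 := by
  by_cases hD0 : D = 0
  · rw [hD0, Derivation.zero_apply]
  obtain ⟨δ, hδ0, hδ, htop⟩ := exists_top_homogeneousPart (grading m l i₀) hD hD0 finite_coords
    (by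
      rintro _ ⟨v, rfl⟩
      exact ⟨_, mk_X_mem_grading i₀ v⟩) adjoin_coords
  -- the top component lowers the weight by at least `2`: otherwise `z` divides its image
  have hδ2 : δ ≤ -2 := by
    by_contra h
    have hmem := homogeneousPart_mem (grading m l i₀) D δ (z_mem_grading i₀)
    exact derivation_z_ne_zero hm hl hδ hδ0
      (apply_eq_zero_of_dvd_apply hδ (z_dvd_of_mem_grading (by omega) hmem))
  -- hence all components of `D (x i₀)` have negative weight
  refine apply_eq_zero_of_dvd_apply hD ?_
  rw [← sum_proj (grading m l i₀) (D (x i₀))]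
  refine Finset.dvd_sum fun j _ => ?_
  rcases le_or_gt j (-1) with hj | hj
  · exact x_dvd_of_mem_grading hj (proj_mem _ _ _)
  · rw [proj_derivation_of_mem (grading m l i₀) D j (x_mem_grading i₀), htop _ (by omega),
      Derivation.zero_apply]
    exact dvd_zero _

end Kernel

end HypersurfaceRing

end MakarLimanov

/-! ### Isomorphisms between the hypersurfaces -/

noncomputable section NonIsomorphic

section Conj

variable {k A B : Type*} [Field k] [CommRing A] [CommRing B] [Algebra k A] [Algebra k B]

/-- The transport of a derivation along an isomorphism. -/
def conjDerivation (φ : A ≃ₐ[k] B) (D : Derivation k A A) : Derivation k B B :=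
  Derivation.mk' (φ.toLinearMap ∘ₗ (D : A →ₗ[k] A) ∘ₗ φ.symm.toLinearMap) fun a b => by
    simp

theorem conjDerivation_apply (φ : A ≃ₐ[k] B) (D : Derivation k A A) (b : B) :
    conjDerivation φ D b = φ (D (φ.symm b)) := rfl

theorem isLocallyNilpotent_conjDerivation (φ : A ≃ₐ[k] B) {D : Derivation k A A}
    (hD : IsLocallyNilpotent D) : IsLocallyNilpotent (conjDerivation φ D) := by
  intro b
  obtain ⟨N, hN⟩ := hD (φ.symm b)
  refine ⟨N, ?_⟩
  have h : ∀ N, (conjDerivation φ D)^[N] b = φ (D^[N] (φ.symm b)) := fun N => by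
    induction N with
    | zero => simp
    | succ N ih =>
      rw [Function.iterate_succ_apply', ih, conjDerivation_apply, φ.symm_apply_apply,
        Function.iterate_succ_apply']
  rw [h, hN, map_zero]

end Conj

namespace HypersurfaceRing

open LaurentPolynomial

variable {n m l : ℕ}

section Standard

/-- The derivation `x₁² ⋯ xₙ² ∂/∂y + m y ^ (m - 1) ∂/∂z` of the polynomial ring. -/
def polyDerivation (n m : ℕ) : Derivation ℂ (MvPolynomial (Coord n) ℂ) (MvPolynomial (Coord n) ℂ) :=
  MvPolynomial.mkDerivation ℂ
    (coordVal 0 (∏ i : Fin n, xVar i ^ 2) ((m : MvPolynomial (Coord n) ℂ) * yVar n ^ (m - 1)) 0)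

theorem polyDerivation_equation : polyDerivation n m (equation n m l) = 0 := by
  have hx : ∀ i : Fin n, polyDerivation n m (xVar i) = 0 := fun i => by
    simp [polyDerivation, xVar, coordVal]
  have hX : polyDerivation n m (∏ i : Fin n, xVar i ^ 2) = 0 := by
    refine Finset.prod_induction _ (fun p => polyDerivation n m p = 0) (fun p q hp hq => ?_)
      (Derivation.map_one_eq_zero _) (fun i _ => ?_)
    · rw [Derivation.leibniz, hp, hq, smul_zero, smul_zero, add_zero]
    · rw [Derivation.leibniz_pow, hx, smul_zero, smul_zero]
  have hy : polyDerivation n m (yVar n) = ∏ i : Fin n, xVar i ^ 2 := by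
    simp [polyDerivation, yVar, coordVal]
  have hz : polyDerivation n m (zVar n) = (m : MvPolynomial (Coord n) ℂ) * yVar n ^ (m - 1) := by
    simp [polyDerivation, zVar, coordVal]
  have ht : polyDerivation n m (tVar n) = 0 := by
    simp [polyDerivation, tVar, coordVal]
  rw [equation, map_sub, Derivation.map_one_eq_zero, Derivation.leibniz, map_sub,
    Derivation.leibniz, Derivation.leibniz_pow _ (yVar n), Derivation.leibniz_pow _ (tVar n), hX,
    hy, hz, ht]
  simp only [smul_eq_mul, nsmul_eq_mul]
  ring

theorem mk_polyDerivation_eq_zero (p : MvPolynomial (Coord n) ℂ) (hp : mk n m l p = 0) :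
    mk n m l (polyDerivation n m p) = 0 := by
  obtain ⟨c, rfl⟩ := Ideal.mem_span_singleton'.mp (Ideal.Quotient.eq_zero_iff_mem.mp hp)
  rw [Derivation.leibniz, polyDerivation_equation, smul_zero, zero_add, smul_eq_mul, map_mul,
    mk_equation, zero_mul]

/-- The locally nilpotent derivation `x₁² ⋯ xₙ² ∂/∂y + m y ^ (m - 1) ∂/∂z`. -/
def stdDerivation (n m l : ℕ) : Derivation ℂ (HypersurfaceRing n m l) (HypersurfaceRing n m l) :=
  Derivation.liftOfSurjective mk_surjective mk_polyDerivation_eq_zero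

theorem stdDerivation_mk (p : MvPolynomial (Coord n) ℂ) :
    stdDerivation n m l (mk n m l p) = mk n m l (polyDerivation n m p) :=
  Derivation.liftOfSurjective_apply mk_surjective mk_polyDerivation_eq_zero p

@[simp]
theorem stdDerivation_x (i : Fin n) : stdDerivation n m l (x i) = 0 := by
  rw [x, stdDerivation_mk]
  simp [polyDerivation, xVar, coordVal]

@[simp]
theorem stdDerivation_y : stdDerivation n m l y = xProd ^ 2 := by
  rw [y, stdDerivation_mk, xProd, ← Finset.prod_pow]
  simp [polyDerivation, yVar, coordVal, x]

@[simp]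
theorem stdDerivation_z :
    stdDerivation n m l z = (m : HypersurfaceRing n m l) * y ^ (m - 1) := by
  rw [z, stdDerivation_mk]
  simp [polyDerivation, zVar, coordVal, y]

@[simp]
theorem stdDerivation_t : stdDerivation n m l t = 0 := by
  rw [t, stdDerivation_mk]
  simp [polyDerivation, tVar, coordVal]

theorem derivation_xProd_sq {D : Derivation ℂ (HypersurfaceRing n m l) (HypersurfaceRing n m l)}
    (hx : ∀ i, D (x i) = 0) : D (xProd ^ 2) = 0 := by
  have h : D xProd = 0 := by
    refine Finset.prod_induction _ (fun p => D p = 0) (fun p q hp hq => ?_)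
      (Derivation.map_one_eq_zero _) (fun i _ => hx i)
    rw [Derivation.leibniz, hp, hq, smul_zero, smul_zero, add_zero]
  rw [Derivation.leibniz_pow, h, smul_zero, smul_zero]

theorem isLocallyNilpotent_stdDerivation : IsLocallyNilpotent (stdDerivation n m l) := by
  have h0 : (0 : HypersurfaceRing n m l) ∈ nilSubalgebra (stdDerivation n m l) := zero_mem _
  have hy : y ∈ nilSubalgebra (stdDerivation n m l) := by
    apply mem_nilSubalgebra_of_apply
    apply mem_nilSubalgebra_of_apply
    rwa [stdDerivation_y, derivation_xProd_sq stdDerivation_x]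
  have htop : nilSubalgebra (stdDerivation n m l) = ⊤ := by
    refine subalgebra_eq_top (fun i => ?_) hy ?_ ?_
    · apply mem_nilSubalgebra_of_apply
      rwa [stdDerivation_x]
    · apply mem_nilSubalgebra_of_apply
      rw [stdDerivation_z]
      exact mul_mem (natCast_mem _ m) (pow_mem hy _)
    · apply mem_nilSubalgebra_of_apply
      rwa [stdDerivation_t]
  intro a
  have : a ∈ nilSubalgebra (stdDerivation n m l) := htop ▸ Algebra.mem_top
  exact this

theorem stdDerivation_ofBase [IsDomain (HypersurfaceRing n m l)] (hl : 1 ≤ l) (p : BaseRing n) :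
    stdDerivation n m l (ofBase n m hl p) = 0 := by
  induction p using LaurentPolynomial.induction_on' with
  | add p q hp hq => rw [map_add, map_add, hp, hq, add_zero]
  | C_mul_T k a =>
    have h1 : stdDerivation n m l (ofBase n m hl (T k)) = 0 :=
      apply_eq_zero_of_isUnit isLocallyNilpotent_stdDerivation ((isUnit_T k).map _)
    have h2 : stdDerivation n m l (ofBase n m hl (C a)) = 0 := by
      induction a using MvPolynomial.induction_on with
      | C c => rw [ofBase_C, Derivation.map_algebraMap]
      | add p q hp hq => rw [map_add, map_add, map_add, hp, hq, add_zero]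
      | mul_X p i hp =>
        rw [map_mul, map_mul, Derivation.leibniz, hp, ofBase_X, stdDerivation_x, smul_zero,
          smul_zero, add_zero]
    rw [map_mul, Derivation.leibniz, h1, h2, smul_zero, smul_zero, add_zero]

/-- The monomials `y ^ j z ^ k` with `j < m`, which generate the coordinate ring as a module over
`ℂ[x₁, …, xₙ][t, t⁻¹]`, numbered by their degree `j + m k`. -/
def basisMonomial (n m l d : ℕ) : HypersurfaceRing n m l := y ^ (d % m) * z ^ (d / m)

theorem span_basisMonomial (hm : 1 ≤ m) (hl : 1 ≤ l) :
    Submodule.span (ofBase n m hl).range (Set.range (basisMonomial n m l)) = ⊤ := by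
  set M := Submodule.span (ofBase n m hl).range (Set.range (basisMonomial n m l)) with hM
  have hmem : ∀ d, basisMonomial n m l d ∈ M := fun d => Submodule.subset_span ⟨d, rfl⟩
  have hP : ∀ (p : BaseRing n) (b), b ∈ M → ofBase n m hl p * b ∈ M := fun p b hb =>
    M.smul_mem (⟨_, p, rfl⟩ : (ofBase n m hl).range) hb
  have hstep : ∀ a : HypersurfaceRing n m l, (∀ d, a * basisMonomial n m l d ∈ M) →
      ∀ b ∈ M, a * b ∈ M := by
    intro a ha b hb
    induction hb using Submodule.span_induction with
    | mem b hb => obtain ⟨d, rfl⟩ := hb; exact ha d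
    | zero => rw [mul_zero]; exact zero_mem _
    | add b c _ _ hb hc => rw [mul_add]; exact add_mem hb hc
    | smul r b _ hb => rw [mul_smul_comm]; exact M.smul_mem r hb
  let S : Subalgebra ℂ (HypersurfaceRing n m l) :=
    { carrier := {a | ∀ b ∈ M, a * b ∈ M}
      mul_mem' := fun {a a'} ha ha' b hb => by rw [mul_assoc]; exact ha _ (ha' b hb)
      add_mem' := fun {a a'} ha ha' b hb => by rw [add_mul]; exact add_mem (ha b hb) (ha' b hb)
      algebraMap_mem' := fun c b hb => by
        rw [← ofBase_C hl]
        exact hP _ b hb }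
  have hS : S = ⊤ := by
    refine subalgebra_eq_top (fun i => ?_) ?_ ?_ ?_
    · intro b hb
      rw [← ofBase_X hl]
      exact hP _ b hb
    · refine hstep _ fun d => ?_
      rcases Nat.lt_or_ge (d % m + 1) m with h | h
      · have h1 : y * basisMonomial n m l d = basisMonomial n m l (d + 1) := by
          have h2 : (d + 1) % m = d % m + 1 := by
            rw [Nat.add_mod, Nat.mod_eq_of_lt (show 1 < m by omega), Nat.mod_eq_of_lt h]
          have h3 : (d + 1) / m = d / m := by
            rw [Nat.succ_div, if_neg, add_zero]
            intro h4
            have := Nat.mod_eq_zero_of_dvd h4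
            omega
          rw [basisMonomial, basisMonomial, h2, h3]
          ring
        rw [h1]
        exact hmem _
      · -- the relation `y ^ m = x₁² ⋯ xₙ² z - t ^ (-ℓ)` lowers the exponent of `y`
        have h1 : d % m + 1 = m := by have := Nat.mod_lt d (show m > 0 by omega); omega
        have hrel : y ^ m = ofBase n m hl (C (∏ i, .X i ^ 2)) * z - ofBase n m hl (T (-l)) := by
          have h2 : ofBase n m hl (T (-l)) * t ^ l = 1 := by
            rw [← val_unitOfT hl, ← Units.val_pow_eq_pow_val, ofBase_T, ← Units.val_mul]
            simp
          have h3 : ofBase n m hl (C (∏ i, .X i ^ 2)) = ∏ i, x i ^ 2 := by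
            simp only [map_prod, map_pow, ofBase_X]
          rw [h3]
          linear_combination (-ofBase n m hl (T (-l))) * relation (n := n) (m := m) (l := l) +
            ((∏ i, x i ^ 2) * z - y ^ m) * h2
        have h4 : y * basisMonomial n m l d = ofBase n m hl (C (∏ i, .X i ^ 2)) *
            basisMonomial n m l (m * (d / m + 1)) - ofBase n m hl (T (-l)) *
              basisMonomial n m l (m * (d / m)) := by
          simp only [basisMonomial, Nat.mul_mod_right, Nat.mul_div_cancel_left _ hm, pow_zero,
            one_mul]
          rw [← mul_assoc, ← pow_succ', h1, hrel]
          ring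
        rw [h4]
        exact sub_mem (hP _ _ (hmem _)) (hP _ _ (hmem _))
    · refine hstep _ fun d => ?_
      have h1 : z * basisMonomial n m l d = basisMonomial n m l (d + m) := by
        rw [basisMonomial, basisMonomial, Nat.add_mod_right, Nat.add_div_right _ hm]
        ring
      rw [h1]
      exact hmem _
    · intro b hb
      have h1 : ofBase n m hl (T 1) = t := by simp
      rw [← h1]
      exact hP _ b hb
  refine eq_top_iff.mpr fun a _ => ?_
  have ha : a ∈ S := hS ▸ Algebra.mem_top
  have h1 : (1 : HypersurfaceRing n m l) ∈ M := by
    have := hmem 0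
    rwa [basisMonomial, Nat.zero_mod, Nat.zero_div, pow_zero, pow_zero, one_mul] at this
  simpa using ha 1 h1

variable [IsDomain (HypersurfaceRing n m l)]

/-- The degree with respect to `stdDerivation`. -/
abbrev stdDegree (a : HypersurfaceRing n m l) : ℕ :=
  lndDegree (stdDerivation n m l) isLocallyNilpotent_stdDerivation a

theorem stdDegree_y (hm : 1 ≤ m) (hl : 1 ≤ l) :
    stdDegree (y : HypersurfaceRing n m l) = 1 := by
  have h0 : stdDerivation n m l y ≠ 0 := by
    rw [stdDerivation_y]
    exact pow_ne_zero 2 (xProd_ne_zero hm hl)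
  have h1 := lndDegree_apply isLocallyNilpotent_stdDerivation (y : HypersurfaceRing n m l)
  rw [stdDerivation_y, (lndDegree_eq_zero_iff _).mpr (derivation_xProd_sq stdDerivation_x)] at h1
  have h2 := mt (lndDegree_eq_zero_iff isLocallyNilpotent_stdDerivation).mp h0
  unfold stdDegree
  omega

theorem y_ne_zero (hm : 1 ≤ m) (hl : 1 ≤ l) : (y : HypersurfaceRing n m l) ≠ 0 := by
  intro h
  have h1 := stdDegree_y (n := n) hm hl
  rw [h, stdDegree, (lndDegree_eq_zero_iff _).mpr (map_zero _)] at h1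
  omega

theorem stdDegree_z (hm : 1 ≤ m) (hl : 1 ≤ l) :
    stdDegree (z : HypersurfaceRing n m l) = m := by
  have := charZero_of_domain_algebra ℂ (HypersurfaceRing n m l)
  have hm0 : (m : HypersurfaceRing n m l) ≠ 0 := Nat.cast_ne_zero.mpr (by omega)
  have h0 : stdDerivation n m l z ≠ 0 := by
    rw [stdDerivation_z]
    exact mul_ne_zero hm0 (pow_ne_zero _ (y_ne_zero hm hl))
  have h1 := lndDegree_apply isLocallyNilpotent_stdDerivation (z : HypersurfaceRing n m l)
  have h3 := stdDegree_y (n := n) hm hl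
  unfold stdDegree at h3 ⊢
  rw [stdDerivation_z, lndDegree_mul _ hm0 (pow_ne_zero _ (y_ne_zero hm hl)), lndDegree_pow, h3,
    (lndDegree_eq_zero_iff _).mpr (Derivation.map_natCast _ m)] at h1
  have h2 := mt (lndDegree_eq_zero_iff isLocallyNilpotent_stdDerivation).mp h0
  omega

theorem stdDegree_ofBase_mul_basisMonomial (hm : 1 ≤ m) (hl : 1 ≤ l) {c : HypersurfaceRing n m l}
    (hc : c ∈ (ofBase n m hl).range) (hc0 : c ≠ 0) (d : ℕ) :
    stdDegree (c * basisMonomial n m l d) = d := by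
  obtain ⟨p, rfl⟩ := hc
  change ofBase n m hl p ≠ 0 at hc0
  change stdDegree (ofBase n m hl p * basisMonomial n m l d) = d
  have hy := pow_ne_zero (d % m) (y_ne_zero (n := n) hm hl)
  have hz := pow_ne_zero (d / m) (z_ne_zero (n := n) (m := m) (l := l) hm)
  have hy1 := stdDegree_y (n := n) hm hl
  have hz1 := stdDegree_z (n := n) hm hl
  unfold stdDegree at *
  rw [basisMonomial, lndDegree_mul _ hc0 (mul_ne_zero hy hz), lndDegree_mul _ hy hz,
    lndDegree_pow, lndDegree_pow, hy1, hz1, mul_one,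
    (lndDegree_eq_zero_iff _).mpr (stdDerivation_ofBase hl p), zero_add, mul_comm]
  exact Nat.mod_add_div d m

/-- Every element is a combination of the basis monomials whose degree is at most its own. -/
theorem exists_sum_basisMonomial (hm : 1 ≤ m) (hl : 1 ≤ l) (a : HypersurfaceRing n m l) :
    ∃ c : ℕ →₀ (ofBase n m hl).range, (∀ d ∈ c.support, d ≤ stdDegree a) ∧
      a = ∑ d ∈ c.support, (c d : HypersurfaceRing n m l) * basisMonomial n m l d := by
  have ha : a ∈ Submodule.span (ofBase n m hl).range (Set.range (basisMonomial n m l)) := by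
    rw [span_basisMonomial hm hl]; trivial
  obtain ⟨c, hc⟩ := Finsupp.mem_span_range_iff_exists_finsupp.mp ha
  have hsum : a = ∑ d ∈ c.support, (c d : HypersurfaceRing n m l) * basisMonomial n m l d :=
    hc.symm
  refine ⟨c, fun d hd => ?_, hsum⟩
  have hdeg : ∀ d ∈ c.support, (taylor (stdDerivation n m l) isLocallyNilpotent_stdDerivation
      ((c d : HypersurfaceRing n m l) * basisMonomial n m l d)).natDegree = d := fun d hd =>
    stdDegree_ofBase_mul_basisMonomial hm hl (c d).2
      (fun h => Finsupp.mem_support_iff.mp hd (Subtype.ext h)) d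
  have h1 := congrArg (taylor (stdDerivation n m l) isLocallyNilpotent_stdDerivation) hsum
  have h2 := congrArg Polynomial.natDegree h1
  rw [map_sum, Polynomial.natDegree_sum_eq_of_disjoint _ _ (by
    rintro d ⟨hd, -⟩ e ⟨he, -⟩ hde
    simp only [Function.onFun, Function.comp_apply]
    rwa [hdeg d hd, hdeg e he]), Finset.sup_congr rfl hdeg] at h2
  change stdDegree a = _ at h2
  rw [h2]
  exact Finset.le_sup (f := fun d => d) hd

/-- The kernel of `stdDerivation` is `ℂ[x₁, …, xₙ][t, t⁻¹]`. -/
theorem stdDerivation_eq_zero_iff (hm : 1 ≤ m) (hl : 1 ≤ l) {a : HypersurfaceRing n m l} :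
    stdDerivation n m l a = 0 ↔ ∃ p, ofBase n m hl p = a := by
  constructor
  · intro h
    obtain ⟨c, hc, ha⟩ := exists_sum_basisMonomial hm hl a
    have h0 : stdDegree a = 0 := (lndDegree_eq_zero_iff _).mpr h
    obtain ⟨p, hp⟩ := (c 0).2
    refine ⟨p, ?_⟩
    change ofBase n m hl p = _ at hp
    have h1 : ∑ d ∈ c.support, (c d : HypersurfaceRing n m l) * basisMonomial n m l d =
        ∑ d ∈ {0}, (c d : HypersurfaceRing n m l) * basisMonomial n m l d := by
      refine Finset.sum_subset (fun d hd => ?_) (fun d _ hd => ?_)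
      · have := hc d hd
        simp; omega
      · rw [Finsupp.notMem_support_iff.mp hd]; simp
    rw [ha, h1, hp]
    simp [basisMonomial]
  · rintro ⟨p, rfl⟩
    exact stdDerivation_ofBase hl p

/-- Elements killed by the square of `stdDerivation` are polynomials of degree at most `1` in `y`
over the kernel. -/
theorem exists_eq_add_mul_y (hm : 2 ≤ m) (hl : 1 ≤ l) {a : HypersurfaceRing n m l}
    (h : stdDerivation n m l (stdDerivation n m l a) = 0) :
    ∃ p₀ p₁ : BaseRing n, a = ofBase n m hl p₀ + ofBase n m hl p₁ * y := by
  obtain ⟨c, hc, ha⟩ := exists_sum_basisMonomial (by omega) hl a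
  have h0 : stdDegree a ≤ 1 := by
    have h1 := (lndDegree_eq_zero_iff isLocallyNilpotent_stdDerivation).mpr h
    rw [lndDegree_apply] at h1
    unfold stdDegree
    omega
  obtain ⟨p₀, hp₀⟩ := (c 0).2
  obtain ⟨p₁, hp₁⟩ := (c 1).2
  refine ⟨p₀, p₁, ?_⟩
  change ofBase n m hl p₀ = _ at hp₀
  change ofBase n m hl p₁ = _ at hp₁
  have h1 : ∑ d ∈ c.support, (c d : HypersurfaceRing n m l) * basisMonomial n m l d =
      ∑ d ∈ Finset.range 2, (c d : HypersurfaceRing n m l) * basisMonomial n m l d := by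
    refine Finset.sum_subset (fun d hd => ?_) (fun d _ hd => ?_)
    · have := hc d hd
      simp; omega
    · rw [Finsupp.notMem_support_iff.mp hd]; simp
  rw [h1] at ha
  rw [ha, hp₀, hp₁, Finset.sum_range_succ, Finset.sum_range_one]
  simp [basisMonomial, Nat.mod_eq_of_lt (show 1 < m by omega),
    Nat.div_eq_of_lt (show 1 < m by omega)]

/-- Every locally nilpotent derivation is a multiple of `stdDerivation`. -/
theorem exists_eq_smul_stdDerivation (hm : 2 ≤ m) (hl : 1 ≤ l)
    {D : Derivation ℂ (HypersurfaceRing n m l) (HypersurfaceRing n m l)}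
    (hD : IsLocallyNilpotent D) : ∃ q : HypersurfaceRing n m l, D = q • stdDerivation n m l := by
  have hx : ∀ i, D (x i) = 0 := derivation_x_eq_zero hm hl hD
  have ht : D t = 0 := apply_eq_zero_of_isUnit hD (isUnit_t hl)
  have hDz : D (xProd ^ 2 * z) = xProd ^ 2 * D z := by
    rw [Derivation.leibniz, derivation_xProd_sq hx, smul_zero, add_zero, smul_eq_mul]
  obtain ⟨q, hq⟩ : xProd ^ 2 ∣ D y :=
    dvd_derivation_y (by omega) hl ht (dvd_mul_right _ _) (hDz ▸ dvd_mul_right _ _)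
  refine ⟨q, derivation_ext (fun i => ?_) ?_ ?_ ?_⟩
  · simp [hx]
  · simp [hq, mul_comm]
  · have h1 := xProd_sq_mul_z_derivation ht hl
    rw [hDz, hq] at h1
    have hX : (xProd ^ 2 : HypersurfaceRing n m l) ≠ 0 :=
      pow_ne_zero 2 (xProd_ne_zero (by omega) hl)
    apply mul_left_cancel₀ hX
    rw [h1]
    simp
    ring
  · simp [ht]

/-- The units of the coordinate ring are the monomials in `t`. -/
theorem exists_eq_of_isUnit (hm : 1 ≤ m) (hl : 1 ≤ l) {u : HypersurfaceRing n m l}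
    (hu : IsUnit u) : ∃ (c : ℂ) (k : ℤ), c ≠ 0 ∧ u = ofBase n m hl (C (.C c) * T k) := by
  obtain ⟨v, huv⟩ := hu.exists_right_inv
  have hv : IsUnit v := IsUnit.of_mul_eq_one_right _ huv
  obtain ⟨p, rfl⟩ := (stdDerivation_eq_zero_iff hm hl).mp
    (apply_eq_zero_of_isUnit isLocallyNilpotent_stdDerivation hu)
  obtain ⟨q, rfl⟩ := (stdDerivation_eq_zero_iff hm hl).mp
    (apply_eq_zero_of_isUnit isLocallyNilpotent_stdDerivation hv)
  have hpq : p * q = C 1 := by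
    apply ofBase_injective (n := n) hm hl
    rw [map_mul, huv, map_one, map_one]
  obtain ⟨r, k, rfl⟩ := eq_C_mul_T_of_mul_eq_C one_ne_zero hpq
  have hr : IsUnit r := by
    have h1 : IsUnit (C r * T k * q) := by rw [hpq, map_one]; exact isUnit_one
    have h2 := (isUnit_of_mul_isUnit_left h1).map
      (eval₂ (RingHom.id (MvPolynomial (Fin n) ℂ)) 1)
    simpa using h2
  obtain ⟨c, hc, rfl⟩ := MvPolynomial.isUnit_iff_eq_C_of_isReduced.mp hr
  exact ⟨c, k, hc.ne_zero, rfl⟩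

end Standard

section Restriction

theorem coeff_C_mul_T {R : Type*} [CommRing R] (r : R) (k j : ℤ) :
    (C r * T k : R[T;T⁻¹]).coeff j = if k = j then r else 0 := by
  rw [← single_eq_C_mul_T, AddMonoidAlgebra.coeff_single, Finsupp.single_apply]

/-- On the divisor `x_{i₀} = 0` the functions from `ℂ[x₁, …, xₙ][t, t⁻¹]` are Laurent polynomials
in `τ ^ m`. -/
theorem coeff_evalDivisor_ofBase (i₀ : Fin n) {ζ : ℂ} (hζ : ζ ^ m = -1) (hl : 1 ≤ l)
    (p : BaseRing n) {j : ℤ} (hj : ¬ (m : ℤ) ∣ j) :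
    (evalDivisor i₀ hζ l (ofBase n m hl p)).coeff j = 0 := by
  have hC : ∀ a, ∃ b, evalDivisor i₀ hζ l (ofBase n m hl (C a)) = C b := by
    intro a
    induction a using MvPolynomial.induction_on with
    | C c => exact ⟨.C c, by rw [ofBase_C, AlgHom.commutes]; rfl⟩
    | add a b ha hb =>
      obtain ⟨a', ha⟩ := ha
      obtain ⟨b', hb⟩ := hb
      exact ⟨a' + b', by simp only [map_add, ha, hb]⟩
    | mul_X a i ha =>
      obtain ⟨a', ha⟩ := ha
      by_cases hi : i = i₀
      · exact ⟨0, by rw [map_mul, map_mul, map_mul, ofBase_X, hi, evalDivisor_x_self]; simp⟩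
      · exact ⟨a' * .X i, by
          rw [map_mul, map_mul, map_mul, ofBase_X, evalDivisor_x_of_ne i₀ hζ hi, ha, map_mul]⟩
  induction p using LaurentPolynomial.induction_on' with
  | add p q hp hq => rw [map_add, map_add, AddMonoidAlgebra.coeff_add, Finsupp.add_apply, hp, hq,
      add_zero]
  | C_mul_T k a =>
    obtain ⟨b, hb⟩ := hC a
    rw [map_mul, map_mul, hb, ofBase_T, evalDivisor_unitOfT_zpow, coeff_C_mul_T, if_neg]
    rintro rfl
    exact hj ⟨-k, by ring⟩

theorem evalDivisor_ofBase_monomial (i₀ : Fin n) {ζ : ℂ} (hζ : ζ ^ m = -1) (hl : 1 ≤ l) (c : ℂ)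
    (k : ℤ) : evalDivisor i₀ hζ l (ofBase n m hl (C (.C c) * T k)) = C (.C c) * T (-m * k) := by
  rw [map_mul, map_mul, ofBase_C, AlgHom.commutes, ofBase_T, evalDivisor_unitOfT_zpow]
  rfl

end Restriction

section Isomorphism

variable {l' : ℕ} [IsDomain (HypersurfaceRing n m l)] [IsDomain (HypersurfaceRing n m l')]

/-- An isomorphism sends `y` to a polynomial of degree at most `1` in `y` over
`ℂ[x₁, …, xₙ][t, t⁻¹]`, whose leading coefficient divides the image of `x₁² ⋯ xₙ²`. -/
theorem exists_map_y_eq (hm : 2 ≤ m) (hl : 1 ≤ l) (hl' : 1 ≤ l')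
    (φ : HypersurfaceRing n m l ≃ₐ[ℂ] HypersurfaceRing n m l') :
    ∃ (p₀ p₁ : BaseRing n) (q : HypersurfaceRing n m l'),
      φ y = ofBase n m hl' p₀ + ofBase n m hl' p₁ * y ∧
        φ (xProd ^ 2) = q * ofBase n m hl' p₁ * xProd ^ 2 := by
  obtain ⟨q, hq⟩ := exists_eq_smul_stdDerivation hm hl'
    (isLocallyNilpotent_conjDerivation φ (isLocallyNilpotent_stdDerivation (n := n) (l := l)))
  have hφ : ∀ a, φ (stdDerivation n m l a) = q * stdDerivation n m l' (φ a) := fun a => by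
    have h := DFunLike.congr_fun hq (φ a)
    rwa [conjDerivation_apply, φ.symm_apply_apply] at h
  have hX0 : φ (xProd ^ 2) ≠ 0 :=
    (map_ne_zero_iff φ φ.injective).mpr (pow_ne_zero 2 (xProd_ne_zero (by omega) hl))
  have hqy : φ (xProd ^ 2) = q * stdDerivation n m l' (φ y) := by
    rw [← hφ, stdDerivation_y]
  have hq0 : q ≠ 0 := by
    rintro rfl
    rw [zero_mul] at hqy
    exact hX0 hqy
  have hX : stdDerivation n m l' (φ (xProd ^ 2)) = 0 := by
    have h := hφ (xProd ^ 2)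
    rw [derivation_xProd_sq stdDerivation_x, map_zero] at h
    exact (mul_eq_zero.mp h.symm).resolve_left hq0
  have hy : stdDerivation n m l' (stdDerivation n m l' (φ y)) = 0 :=
    apply_eq_zero_of_dvd isLocallyNilpotent_stdDerivation hX0 ⟨q, by rw [hqy, mul_comm]⟩ hX
  obtain ⟨p₀, p₁, hp⟩ := exists_eq_add_mul_y hm hl' hy
  refine ⟨p₀, p₁, q, hp, ?_⟩
  rw [hqy, hp, map_add, Derivation.leibniz, stdDerivation_ofBase, stdDerivation_ofBase,
    stdDerivation_y, smul_zero, add_zero, zero_add, smul_eq_mul, mul_assoc]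

/-- Applying the preceding statement also to the inverse isomorphism shows that the leading
coefficient is a unit. -/
theorem exists_map_y_eq_of_isUnit (hm : 2 ≤ m) (hl : 1 ≤ l) (hl' : 1 ≤ l')
    (φ : HypersurfaceRing n m l ≃ₐ[ℂ] HypersurfaceRing n m l') :
    ∃ p₀ p₁ : BaseRing n, φ y = ofBase n m hl' p₀ + ofBase n m hl' p₁ * y ∧
      IsUnit (ofBase n m hl' p₁) ∧ xProd ^ 2 ∣ φ (xProd ^ 2) := by
  obtain ⟨p₀, p₁, q, hy, hX⟩ := exists_map_y_eq hm hl hl' φ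
  obtain ⟨-, r₁, s, -, hX'⟩ := exists_map_y_eq hm hl' hl φ.symm
  refine ⟨p₀, p₁, hy, ?_, ⟨_, hX.trans (mul_comm _ _)⟩⟩
  have h1 : xProd ^ 2 = φ (s * ofBase n m hl r₁) * φ (xProd ^ 2) := by
    rw [← map_mul, ← hX', φ.apply_symm_apply]
  rw [hX] at h1
  have h2 : (xProd ^ 2 : HypersurfaceRing n m l') ≠ 0 :=
    pow_ne_zero 2 (xProd_ne_zero (by omega) hl')
  refine IsUnit.of_mul_eq_one (φ (s * ofBase n m hl r₁) * q) (mul_right_cancel₀ h2 ?_)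
  linear_combination -h1

/-- An isomorphism sends `t` to a multiple of `t` or of `t⁻¹`. -/
theorem exists_map_t_eq (hm : 2 ≤ m) (hl : 1 ≤ l) (hl' : 1 ≤ l')
    (φ : HypersurfaceRing n m l ≃ₐ[ℂ] HypersurfaceRing n m l') :
    ∃ (c : ℂ) (k : ℤ), c ≠ 0 ∧ φ t = ofBase n m hl' (C (.C c) * T k) ∧ (k = 1 ∨ k = -1) := by
  obtain ⟨c, k, hc, hk⟩ := exists_eq_of_isUnit (by omega) hl'
    ((isUnit_t (n := n) (m := m) hl).map φ)
  obtain ⟨d, j, hd, hj⟩ := exists_eq_of_isUnit (by omega) hl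
    ((isUnit_t (n := n) (m := m) hl').map φ.symm)
  refine ⟨c, k, hc, hk, ?_⟩
  -- both sides are units, so that integral powers of `φ t` can be computed
  let w : (BaseRing n)ˣ :=
    Units.map ((C.comp MvPolynomial.C : ℂ →+* BaseRing n) : ℂ →* BaseRing n) (Units.mk0 c hc)
  have hw : (((w * unitT _ ^ k) ^ j : (BaseRing n)ˣ) : BaseRing n) =
      C (.C (c ^ j)) * T (k * j) := by
    rw [val_mul_unitT_zpow_zpow, ← map_zpow, Units.coe_map, Units.val_zpow_eq_zpow_val]
    rfl
  have hu : Units.map (φ : HypersurfaceRing n m l →* HypersurfaceRing n m l') (unitOfT hl) =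
      Units.map (ofBase n m hl' : BaseRing n →* HypersurfaceRing n m l')
        (w * unitT _ ^ k) := by
    ext1
    refine hk.trans (congrArg (ofBase n m hl') ?_)
    rw [Units.val_mul, val_unitT_zpow]
    rfl
  have h1 : φ (ofBase n m hl (T j)) = ofBase n m hl' (C (.C (c ^ j)) * T (k * j)) := by
    have h2 := congrArg Units.val (congrArg (· ^ j) hu)
    simp only [← map_zpow] at h2
    rw [ofBase_T, ← hw]
    exact h2
  have h3 : t = ofBase n m hl' (C (.C (d * c ^ j)) * T (k * j)) := by
    have h4 := congrArg φ hj
    rw [φ.apply_symm_apply, map_mul, map_mul, h1, ofBase_C, AlgEquiv.commutes, ← ofBase_C hl',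
      ← map_mul] at h4
    rw [h4]
    simp only [map_mul, mul_assoc]
  have h5 : (C (.C (d * c ^ j)) * T (k * j) : BaseRing n) = T 1 := by
    apply ofBase_injective (m := m) (by omega) hl'
    rw [← h3]
    simp
  have h6 := congrArg degree h5
  rw [degree_T, degree_C_mul_T _ _ (by simpa using ⟨hd, zpow_ne_zero j hc⟩)] at h6
  have h7 : k * j = 1 := by exact_mod_cast h6
  exact Int.eq_one_or_neg_one_of_mul_eq_one h7

/-- Restricting an isomorphism to the divisor `x_{i₀} = 0`, parametrized by `τ`, compares the
orders `ℓ'` and `ℓ` of `y` in `τ`, up to sign and modulo the order `m` of `t`. -/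
theorem modEq_of_algEquiv (hn : 1 ≤ n) (hm : 2 ≤ m) (hl : 1 ≤ l) (hl' : 1 ≤ l')
    (hlm' : Nat.Coprime l' m) (φ : HypersurfaceRing n m l ≃ₐ[ℂ] HypersurfaceRing n m l') :
    (l' : ℤ) ≡ l [ZMOD m] ∨ (l' : ℤ) ≡ -l [ZMOD m] := by
  obtain ⟨ζ, hζ⟩ := IsAlgClosed.exists_pow_nat_eq (-1 : ℂ) (n := m) (by omega)
  have hζ0 : ζ ≠ 0 := by
    rintro rfl
    rw [zero_pow (by omega)] at hζ
    simp at hζ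
  let i₀ : Fin n := ⟨0, by omega⟩
  let ev := evalDivisor i₀ hζ l'
  obtain ⟨p₀, p₁, hy, hp₁, hX⟩ := exists_map_y_eq_of_isUnit hm hl hl' φ
  obtain ⟨c, ε, hc, ht, hε⟩ := exists_map_t_eq hm hl hl' φ
  obtain ⟨d, k, hd, hk⟩ := exists_eq_of_isUnit (by omega) hl' hp₁
  have hevX : ev (φ (xProd ^ 2)) = 0 := by
    obtain ⟨r, hr⟩ := hX
    rw [hr, map_mul, map_pow, evalDivisor_xProd]
    simp
  have hevt : ev (φ t) = C (.C c) * T (-m * ε) := by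
    rw [ht]
    exact evalDivisor_ofBase_monomial i₀ hζ hl' c ε
  have hevy : ev (φ y) = ev (ofBase n m hl' p₀) + C (.C (d * ζ)) * T (-m * k + l') := by
    rw [hy, hk, map_add, map_mul]
    have h1 := evalDivisor_ofBase_monomial i₀ hζ hl' d k
    rw [show ev (ofBase n m hl' (C (.C d) * T k)) = _ from h1,
      show ev y = _ from evalDivisor_y i₀ hζ, T_add, map_mul, map_mul]
    ring
  have hrel : ev (φ t) ^ l * -(ev (φ y) ^ m) = 1 := by
    have h1 := congrArg (fun a => ev (φ a)) (relation' (n := n) (m := m) (l := l))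
    simp only [map_mul, map_sub, map_one] at h1
    rw [hevX, zero_mul, zero_sub, map_pow φ, map_pow ev, map_pow φ, map_pow ev] at h1
    exact h1
  -- being a unit, `ev (φ y)` is a monomial; its order is not divisible by `m`
  have hmon : ev (φ y) * (-(ev (φ t) ^ l) * ev (φ y) ^ (m - 1)) = C 1 := by
    rw [map_one, ← hrel]
    obtain ⟨r, rfl⟩ := Nat.exists_eq_add_of_le' (show 1 ≤ m by omega)
    rw [Nat.add_sub_cancel]
    ring
  obtain ⟨r, j, hr⟩ := eq_C_mul_T_of_mul_eq_C one_ne_zero hmon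
  have hndvd : ¬ (m : ℤ) ∣ -m * k + l' := by
    intro h
    have h1 : (m : ℤ) ∣ l' := (Int.dvd_add_right ⟨-k, by ring⟩).mp h
    have h2 := Nat.eq_one_of_dvd_coprimes hlm' (Int.natCast_dvd_natCast.mp h1) dvd_rfl
    omega
  have hj : j = -m * k + l' := by
    have h1 := congrArg (fun p => p.coeff (-m * k + l')) (hevy.symm.trans hr)
    simp only [AddMonoidAlgebra.coeff_add, Finsupp.add_apply, coeff_C_mul_T] at h1
    rw [show (ev (ofBase n m hl' p₀)).coeff (-m * k + l') = 0 from
      coeff_evalDivisor_ofBase i₀ hζ hl' p₀ hndvd, if_pos trivial, zero_add] at h1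
    by_contra hne
    rw [if_neg hne] at h1
    exact mul_ne_zero hd hζ0 (MvPolynomial.C_eq_zero.mp h1)
  have hr0 : r ≠ 0 := by
    rintro rfl
    rw [map_zero, zero_mul] at hr
    rw [hr, zero_mul, map_one] at hmon
    exact zero_ne_one hmon
  have hexp : l * (-m * ε) + m * j = 0 := by
    have h1 : (C (-((.C c) ^ l * r ^ m)) * T (l * (-m * ε) + m * j) : BaseRing n) = T 0 := by
      rw [T_zero, ← hrel, hevt, hr, mul_pow, mul_pow, T_pow, T_pow, T_add, map_neg, map_mul,
        map_pow, map_pow]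
      ring
    have h2 := congrArg degree h1
    rw [degree_T, degree_C_mul_T _ _ (by simp [hc, hr0])] at h2
    exact_mod_cast h2
  have hfinal : (l' : ℤ) - l * ε = m * k := by
    have hm0 : (m : ℤ) ≠ 0 := by omega
    apply mul_left_cancel₀ hm0
    rw [hj] at hexp
    linear_combination hexp
  rcases hε with rfl | rfl
  · left
    exact (Int.modEq_iff_dvd.mpr ⟨k, by linear_combination hfinal⟩).symm
  · right
    exact (Int.modEq_iff_dvd.mpr ⟨k, by linear_combination hfinal⟩).symm

end Isomorphism

end HypersurfaceRing

end NonIsomorphic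

/-! ### Passage to schemes -/

open scoped LaurentPolynomial TensorProduct

noncomputable section Schemes

section SpecOver

variable {A B : Type} [CommRing A] [Algebra ℂ A] [CommRing B] [Algebra ℂ B]

/-- Isomorphic `ℂ`-algebras have isomorphic spectra over `ℂ`. -/
def specOverIso (e : A ≃ₐ[ℂ] B) : specOver A ≅ specOver B :=
  let i : Spec (.of A) ≅ Spec (.of B) := Scheme.Spec.mapIso e.symm.toRingEquiv.toCommRingCatIso.op
  Over.isoMk (f := specOver A) (g := specOver B) i (by
    change Spec.map (CommRingCat.ofHom (e.symm : B →+* A)) ≫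
      Spec.map (CommRingCat.ofHom (algebraMap ℂ B)) = Spec.map (CommRingCat.ofHom (algebraMap ℂ A))
    rw [← Spec.map_comp, ← CommRingCat.ofHom_comp]
    exact congrArg (fun g => Spec.map (CommRingCat.ofHom g))
      (AlgHom.comp_algebraMap e.symm.toAlgHom))

/-- The functor `Spec` being fully faithful, an isomorphism over `ℂ` between spectra comes from
an isomorphism of `ℂ`-algebras. -/
theorem nonempty_algEquiv_of_specOverIso (f : specOver A ≅ specOver B) :
    Nonempty (A ≃ₐ[ℂ] B) := by
  let i : Spec (.of B) ≅ Spec (.of A) := (Over.forget _).mapIso f.symm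
  let e := (Scheme.Spec.preimageIso i).unop
  refine ⟨AlgEquiv.ofRingEquiv (f := e.commRingCatIsoToRingEquiv) fun c => ?_⟩
  have h : i.hom ≫ Spec.map (CommRingCat.ofHom (algebraMap ℂ A)) =
      Spec.map (CommRingCat.ofHom (algebraMap ℂ B)) := Over.w f.inv
  have h2 : Spec.map e.hom = i.hom := Scheme.Spec.map_preimage i.hom
  rw [← h2, ← Spec.map_comp] at h
  exact congrArg (fun g => g.hom c) (Spec.map_injective h)

/-- The cylinder over the spectrum of `A` is the spectrum of `A[u, u⁻¹]`. -/
def puncturedCylinderIso (A : Type) [CommRing A] [Algebra ℂ A] :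
    puncturedCylinder (specOver A) ≅ specOver A[T;T⁻¹] :=
  Over.isoMk (f := puncturedCylinder (specOver A)) (g := specOver (A ⊗[ℂ] ℂ[T;T⁻¹]))
      (pullbackSpecIso ℂ A ℂ[T;T⁻¹]) (pullbackSpecIso_hom_base ℂ A _) ≪≫
    specOverIso ((AddMonoidAlgebra.scalarTensorEquiv ℂ A).restrictScalars ℂ)

theorem isFactorialAffineVariety_specOver (A : Type) [CommRing A] [Algebra ℂ A] [IsDomain A]
    [UniqueFactorizationMonoid A] [Algebra.FiniteType ℂ A] :
    IsFactorialAffineVariety (specOver A) where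
  isAffine := inferInstanceAs (IsAffine (Spec (.of A)))
  isIntegral := inferInstanceAs (IsIntegral (Spec (.of A)))
  finiteType := by
    change LocallyOfFiniteType (Spec.map _)
    rw [HasRingHomProperty.Spec_iff (P := @LocallyOfFiniteType)]
    exact RingHom.finiteType_algebraMap.mpr inferInstance
  factorial := (Scheme.ΓSpecIso (.of A)).symm.commRingCatIsoToRingEquiv.toMulEquiv
    |>.uniqueFactorizationMonoid inferInstance

theorem topologicalKrullDim_specOver (A : Type) [CommRing A] [Algebra ℂ A] :
    topologicalKrullDim (specOver A).left = ringKrullDim A :=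
  PrimeSpectrum.topologicalKrullDim_eq_ringKrullDim A

end SpecOver

section Hypersurface

variable {n m l l' : ℕ}

theorem isFactorialAffineVariety_hypersurface (n m : ℕ) (hl : 1 ≤ l) (hlm : Nat.Coprime l m) :
    IsFactorialAffineVariety (hypersurface n m l) := by
  have := HypersurfaceRing.isDomain n m hl hlm
  have := HypersurfaceRing.uniqueFactorizationMonoid n m hl hlm
  have : Algebra.FiniteType ℂ (HypersurfaceRing n m l) :=
    inferInstanceAs (Algebra.FiniteType ℂ (MvPolynomial (Coord n) ℂ ⧸ Ideal.span {equation n m l}))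
  exact isFactorialAffineVariety_specOver (HypersurfaceRing n m l)

theorem topologicalKrullDim_hypersurface (hn : 1 ≤ n) (hm : 1 ≤ m) (hl : 1 ≤ l)
    (hlm : Nat.Coprime l m) :
    topologicalKrullDim (hypersurface n m l).left = ((n + 2 : ℕ) : WithBot ℕ∞) :=
  (topologicalKrullDim_specOver (HypersurfaceRing n m l)).trans
    (le_antisymm (HypersurfaceRing.ringKrullDim_le n m hl)
      (HypersurfaceRing.ringKrullDim_ge hn hm hl hlm))

theorem isEmpty_hypersurface_iso (hn : 1 ≤ n) (hm : 2 ≤ m) (hl : 1 ≤ l) (hl' : 1 ≤ l')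
    (hlm : Nat.Coprime l m) (hlm' : Nat.Coprime l' m)
    (hpos : ¬ (l' : ℤ) ≡ (l : ℤ) [ZMOD (m : ℤ)])
    (hneg : ¬ (l' : ℤ) ≡ -(l : ℤ) [ZMOD (m : ℤ)]) :
    IsEmpty (hypersurface n m l ≅ hypersurface n m l') := by
  refine ⟨fun f => ?_⟩
  have := HypersurfaceRing.isDomain n m hl hlm
  have := HypersurfaceRing.isDomain n m hl' hlm'
  have f' : specOver (HypersurfaceRing n m l) ≅ specOver (HypersurfaceRing n m l') := f
  obtain ⟨φ⟩ := nonempty_algEquiv_of_specOverIso f'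
  exact (HypersurfaceRing.modEq_of_algEquiv hn hm hl hl' hlm' φ).elim hpos hneg

theorem nonempty_puncturedCylinder_iso (n m : ℕ) (hl : 1 ≤ l) (hl' : 1 ≤ l')
    (hlm : Nat.Coprime l m) (hlm' : Nat.Coprime l' m) :
    Nonempty (puncturedCylinder (hypersurface n m l) ≅
      puncturedCylinder (hypersurface n m l')) := by
  obtain ⟨e⟩ := HypersurfaceRing.nonempty_cylinderEquiv n m hl hlm
  obtain ⟨e'⟩ := HypersurfaceRing.nonempty_cylinderEquiv n m hl' hlm'
  exact ⟨puncturedCylinderIso (HypersurfaceRing n m l) ≪≫ specOverIso (e.trans e'.symm) ≪≫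
    (puncturedCylinderIso (HypersurfaceRing n m l')).symm⟩

end Hypersurface

end Schemes

end LaurentCancellation

theorem mainTheorem2 (n m l l' : ℕ) (hn : 1 ≤ n) (hm : 2 ≤ m) (hl : 1 ≤ l) (hl' : 1 ≤ l')
    (hlm : Nat.Coprime l m) (hlm' : Nat.Coprime l' m)
    (hpos : ¬ (l' : ℤ) ≡ (l : ℤ) [ZMOD (m : ℤ)])
    (hneg : ¬ (l' : ℤ) ≡ -(l : ℤ) [ZMOD (m : ℤ)]) :
    (LaurentCancellation.IsFactorialAffineVariety (LaurentCancellation.hypersurface n m l) ∧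
      topologicalKrullDim (LaurentCancellation.hypersurface n m l).left = ((n + 2 : ℕ) : WithBot ℕ∞)) ∧
    (LaurentCancellation.IsFactorialAffineVariety (LaurentCancellation.hypersurface n m l') ∧
      topologicalKrullDim (LaurentCancellation.hypersurface n m l').left = ((n + 2 : ℕ) : WithBot ℕ∞)) ∧
    IsEmpty (LaurentCancellation.hypersurface n m l ≅ LaurentCancellation.hypersurface n m l') ∧
    Nonempty (LaurentCancellation.puncturedCylinder (LaurentCancellation.hypersurface n m l) ≅
      LaurentCancellation.puncturedCylinder (LaurentCancellation.hypersurface n m l')) := by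
  have hm' : 1 ≤ m := by omega
  exact ⟨⟨LaurentCancellation.isFactorialAffineVariety_hypersurface n m hl hlm,
      LaurentCancellation.topologicalKrullDim_hypersurface hn hm' hl hlm⟩,
    ⟨LaurentCancellation.isFactorialAffineVariety_hypersurface n m hl' hlm',
      LaurentCancellation.topologicalKrullDim_hypersurface hn hm' hl' hlm'⟩,
    LaurentCancellation.isEmpty_hypersurface_iso hn hm hl hl' hlm hlm' hpos hneg,
    LaurentCancellation.nonempty_puncturedCylinder_iso n m hl hl' hlm hlm'⟩
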